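/- Consider the standard deterministic $\mathsf{LOCAL}$ model: the network is a finite simple graph $G$ with $n$ nodes and maximum degree $\Delta$. Each node has a unique identifier from $\{0,\dots,N-1\}$, where $N\le n^{a}$ for a constant $a$, and initially knows its identifier, its degree, $N$, and a natural number $L$ that approximates $\log_2\Delta$ up to a constant factor $K$, that is, $\log_2\Delta\le K L$ and $L\le K\log_2\Delta$ (with the convention $\log_2 0:=0$). In each synchronous round each node can send a message of arbitrary size to each of its neighbors, and local computation is unlimited. All nodes run the same deterministic algorithm, and each node halts with an output that says which of its incident edges are selected. Theorem. There is a deterministic distributed algorithm that computes a maximal matching of $G$ in $O(\log^2\Delta\cdot\log n)$ rounds. That is, for all constants $a,K\in\mathbb{N}$ there are such an algorithm and a constant $C$ (depending only on $a$ and $K$) such that on every such network all nodes halt within $C\cdot\log_2^2\Delta\cdot\log_2 n$ rounds, the two endpoints of each edge agree on whether it is selected, and the selected edges form a maximal matching of $G$, i.e. a set of pairwise disjoint edges to which no further edge of $G$ can be added. -/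

import Mathlib

/-- A set `M` of edges of `G` is a matching: no two distinct edges of `M` share a node. -/
def IsEdgeMatching {V : Type*} (G : SimpleGraph V) (M : Set (Sym2 V)) : Prop :=
  M ⊆ G.edgeSet ∧ ∀ e ∈ M, ∀ f ∈ M, e ≠ f → ∀ v : V, ¬ (v ∈ e ∧ v ∈ f)

/-- A matching is maximal if no edge of `G` can be added to it so that it stays a matching. -/
def IsMaximalEdgeMatching {V : Type*} (G : SimpleGraph V) (M : Set (Sym2 V)) : Prop :=
  IsEdgeMatching G M ∧ ∀ e ∈ G.edgeSet, e ∉ M → ¬ IsEdgeMatching G (insert e M)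

/-- The graph `G` as a communication network: the nodes carry unique identifiers, and every node
`v` addresses its neighbors through ports numbered `0, …, deg v - 1` in an arbitrary order. -/
structure Network {V : Type*} [Fintype V] (G : SimpleGraph V) [DecidableRel G.Adj] where
  /-- the identifier of a node -/
  id : V → ℕ
  id_injective : Function.Injective id
  /-- the neighbor behind a port -/
  port : ∀ v : V, Fin (G.degree v) ≃ G.neighborSet v

/-- A deterministic algorithm in the `LOCAL` model that selects a set of edges. All nodes run the
same algorithm; local computation and message sizes are unlimited. `State d` is the type of states
of a node of degree `d`. -/
structure LocalAlgorithm where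
  State : ℕ → Type
  Msg : Type
  /-- The initial state of a node. It depends only on the global parameters `N` and `L` that all
  nodes know, on the degree `d` of the node, and on its own identifier. -/
  init : (N L d ident : ℕ) → State d
  /-- the message which a node sends through a given port in the current round -/
  send : {d : ℕ} → State d → Fin d → Msg
  /-- the new state after the messages of this round have arrived through the ports -/
  receive : {d : ℕ} → State d → (Fin d → Msg) → State d
  /-- `none` while the node is running; `some o` if it has halted with the final output `o`, where
  `o p` says whether the edge behind port `p` is selected -/
  output : {d : ℕ} → State d → Option (Fin d → Bool)

namespace Network

variable {V : Type*} [Fintype V] {G : SimpleGraph V} [DecidableRel G.Adj]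

/-- The node behind port `p` of `v`. -/
def nbr (net : Network G) (v : V) (p : Fin (G.degree v)) : V := (net.port v p : V)

/-- The port through which the node behind port `p` of `v` reaches `v`. -/
def backPort (net : Network G) (v : V) (p : Fin (G.degree v)) : Fin (G.degree (net.nbr v p)) :=
  (net.port (net.nbr v p)).symm ⟨v, G.adj_symm (net.port v p).2⟩

end Network

namespace LocalAlgorithm

variable {V : Type*} [Fintype V] {G : SimpleGraph V} [DecidableRel G.Adj]

/-- One synchronous round: every node that is still running receives the messages which its
neighbors send according to their current states, and updates its state. A node that has halted
keeps its final state. -/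
def round (A : LocalAlgorithm) (net : Network G) (s : ∀ v : V, A.State (G.degree v)) (v : V) :
    A.State (G.degree v) :=
  match A.output (s v) with
  | some _ => s v
  | none => A.receive (s v) fun p => A.send (s (net.nbr v p)) (net.backPort v p)

/-- The states of all nodes after `t` rounds. -/
def run (A : LocalAlgorithm) (net : Network G) (N L : ℕ) : ℕ → ∀ v : V, A.State (G.degree v)
  | 0 => fun v => A.init N L (G.degree v) (net.id v)
  | t + 1 => A.round net (A.run net N L t)

/-- Within `t` rounds all nodes have halted, and their outputs describe one and the same edge set
`M` (the two endpoints of every edge agree on whether it belongs to `M`), which is a maximal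
matching of `G`. -/
def ComputesMaximalMatchingWithin (A : LocalAlgorithm) (net : Network G) (N L t : ℕ) : Prop :=
  ∃ M : Set (Sym2 V), IsMaximalEdgeMatching G M ∧
    ∀ v : V, ∃ o : Fin (G.degree v) → Bool, A.output (A.run net N L t v) = some o ∧
      ∀ p : Fin (G.degree v), o p = true ↔ s(v, net.nbr v p) ∈ M

end LocalAlgorithm

/-! A maximal matching is a maximal independent set of the line graph, and one round on the network
simulates one label rule on the line graph (`simulate_output`). It therefore suffices to compute an
independent set by few rules in a graph `H` where each neighborhood is covered by two cliques.

A phase removes at least 1/128 of the nodes still alive, so O(log n) phases suffice. Give an alive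
node the weight `w` = alive degree + 1 and a value `x`, a power of two of order `1 / w`. The
potential is `gain - c * cost`, where `gain = ∑ w x` and `cost` sums `w e * x e * x f` over ordered
adjacent pairs. The cliques keep the values around a node below 1/4 in total, so for `c ≤ 3` the
potential starts at 1/64 of the number of alive nodes or more (`start_gain_sub_cost`). Once the
values are 0 or 1, `gain - cost` is at most the weight of the nodes of value 1 without neighbors of
value 1 (`gain_sub_cost_le_chosen`). Selecting these removes at least half their weight in nodes,
since a node sees at most two of them (`sum_aliveDeg_le`).

Values are rounded in `l = O(log Δ)` levels, each doubling or deleting the smallest ones. The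
potential is affine in every coordinate, so one of the two choices never hurts; simultaneous choices
lose only on adjacent pairs acting together. Each level schedules the nodes in O(`l`) time slots so
that these pairs carry at most a `1 / l` fraction of the cost. Lowering `c` by the factor `1 + 1 /
l` pays for this, and `(1 + 1 / l) ^ l ≤ 3` (`roundingRules_spec`). The slots come from polynomial
codes (`exists_isColorCode`): one round of weighted recoloring leaves O(`l ^ 4`) colors, then every
node waits for a code letter with few conflicts (`slots_ne_none`, `slots_mono_weight`). A level
costs O(`l`) rounds and a phase O(`l ^ 2`). -/

/-- A rule by which a node of a labelled graph computes its new label from its own label and the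
labels of its neighbors. -/
abbrev LabelRule (α : Type) := α → Multiset α → α

/-! ### Synchronous label rules on a finite graph -/

section Rules

variable {ι : Type*} [Fintype ι] {α : Type}

open Classical in
/-- The neighbors of `e` in a finite graph. -/
noncomputable def nbhd (H : SimpleGraph ι) (e : ι) : Finset ι := Finset.univ.filter (H.Adj e)

@[simp] theorem mem_nbhd {H : SimpleGraph ι} {e f : ι} : f ∈ nbhd H e ↔ H.Adj e f := by
  classical
  simp [nbhd]

/-- All nodes apply the rule `r` simultaneously. -/
noncomputable def applyRule (H : SimpleGraph ι) (r : LabelRule α) (σ : ι → α) : ι → α :=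
  fun e => r (σ e) ((nbhd H e).val.map σ)

/-- Apply the rules of a list one after the other. -/
noncomputable def runRules (H : SimpleGraph ι) : List (LabelRule α) → (ι → α) → ι → α
  | [], σ => σ
  | r :: P, σ => runRules H P (applyRule H r σ)

theorem runRules_append (H : SimpleGraph ι) (P Q : List (LabelRule α)) (σ : ι → α) :
    runRules H (P ++ Q) σ = runRules H Q (runRules H P σ) := by
  induction P generalizing σ with
  | nil => rfl
  | cons r P ih => exact ih _

theorem sum_map_nbhd {M : Type*} [AddCommMonoid M] (H : SimpleGraph ι) (σ : ι → α) (e : ι)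
    (g : α → M) : (((nbhd H e).val.map σ).map g).sum = ∑ f ∈ nbhd H e, g (σ f) := by
  rw [Multiset.map_map]; rfl

end Rules

/-! ### Simulating rules on the line graph by message passing -/

/-- The state of a node that simulates label rules on the edges: the edge behind every port
carries a label, and `todo` lists the rules still to be applied (`none` before the identifiers
have been exchanged). -/
structure PortState (α : Type) (d : ℕ) where
  N : ℕ
  L : ℕ
  ident : ℕ
  todo : Option (List (LabelRule α))
  label : Fin d → α

/-- The labels of the edges behind the other ports. -/
def PortState.others {α : Type} {d : ℕ} (s : PortState α d) (p : Fin d) : Multiset α :=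
  (Finset.univ.erase p).val.map s.label

/-- The distributed algorithm which runs a list of label rules on the line graph. If `L = 0` it
selects all edges at once. -/
def simulate {α : Type} (start : ℕ → ℕ → Sym2 ℕ → α) (prog : ℕ → ℕ → List (LabelRule α))
    (out : α → Bool) (dflt : α) : LocalAlgorithm where
  State := PortState α
  Msg := ℕ × Multiset α
  init N L _ i := ⟨N, L, i, if L = 0 then some [] else none, fun _ => dflt⟩
  send s p := (s.ident, s.others p)
  receive s m :=
    match s.todo with
    | none => { s with
        todo := some (prog s.N s.L)
        label := fun p => start s.N s.L s(s.ident, (m p).1) }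
    | some [] => s
    | some (r :: P) => { s with
        todo := some P
        label := fun p => r (s.label p) (s.others p + (m p).2) }
  output s :=
    match s.todo with
    | some [] => some fun p => out (s.label p)
    | _ => none

section Simulation

variable {V : Type*} [Fintype V] {G : SimpleGraph V} [DecidableRel G.Adj]

/-- The edge behind a port. -/
def Network.edge (net : Network G) (v : V) (p : Fin (G.degree v)) : G.edgeSet :=
  ⟨s(v, net.nbr v p), (net.port v p).2⟩

theorem Network.adj_nbr (net : Network G) (v : V) (p : Fin (G.degree v)) :
    G.Adj v (net.nbr v p) := (net.port v p).2

theorem Network.edge_injective (net : Network G) (v : V) : Function.Injective (net.edge v) := by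
  intro p q h
  have h1 : s(v, net.nbr v p) = s(v, net.nbr v q) := congrArg Subtype.val h
  have h2 : net.nbr v p = net.nbr v q := Sym2.congr_right.1 h1
  exact (net.port v).injective (Subtype.ext h2)

theorem Network.exists_edge_eq (net : Network G) (v : V) (e : G.edgeSet) (h : v ∈ e.1) :
    ∃ p, net.edge v p = e := by
  obtain ⟨w, hw⟩ := Sym2.mem_iff_exists.1 h
  have hadj : G.Adj v w := by
    have := e.2
    rw [hw] at this
    exact this
  refine ⟨(net.port v).symm ⟨w, hadj⟩, Subtype.ext ?_⟩
  rw [hw]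
  simp [Network.edge, Network.nbr]

theorem Network.nbr_backPort (net : Network G) (v : V) (p : Fin (G.degree v)) :
    net.nbr (net.nbr v p) (net.backPort v p) = v :=
  congrArg Subtype.val ((net.port (net.nbr v p)).apply_symm_apply _)

theorem Network.edge_backPort (net : Network G) (v : V) (p : Fin (G.degree v)) :
    net.edge (net.nbr v p) (net.backPort v p) = net.edge v p := by
  apply Subtype.ext
  change s(net.nbr v p, net.nbr (net.nbr v p) (net.backPort v p)) = s(v, net.nbr v p)
  rw [net.nbr_backPort, Sym2.eq_swap]

theorem simulate_output_zero {α : Type} (start : ℕ → ℕ → Sym2 ℕ → α)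
    (prog : ℕ → ℕ → List (LabelRule α)) (out : α → Bool) (dflt : α) (net : Network G) (N : ℕ) (v : V) :
    (simulate start prog out dflt).output ((simulate start prog out dflt).run net N 0 0 v) =
    some fun _ => out dflt := by
  simp [LocalAlgorithm.run, simulate]

variable [Fintype G.edgeSet]

-- An edge adjacent to `e` meets it in exactly one endpoint. Each endpoint sees its own share
-- locally, so a single message completes the multiset that a rule needs.
open Classical in
theorem Network.nbhd_edge (net : Network G) (v : V) (p : Fin (G.degree v)) :
    (nbhd G.lineGraph (net.edge v p)).val =
      (Finset.univ.erase p).val.map (net.edge v) +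
      (Finset.univ.erase (net.backPort v p)).val.map (net.edge (net.nbr v p)) := by
  -- In a simple graph an edge through both endpoints is the edge behind `p` itself, so nothing is
  -- counted twice.
  have hd : Disjoint ((Finset.univ.erase p).image (net.edge v))
      ((Finset.univ.erase (net.backPort v p)).image (net.edge (net.nbr v p))) := by
    rw [Finset.disjoint_left]
    intro e h1 h2
    simp only [Finset.mem_image, Finset.mem_erase, Finset.mem_univ, and_true] at h1 h2
    obtain ⟨q, hq, rfl⟩ := h1
    obtain ⟨q', hq', h⟩ := h2
    apply hq
    apply net.edge_injective v
    have h3 : net.nbr v p ∈ (net.edge v q).1 := by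
      rw [← h]; exact Sym2.mem_mk_left _ _
    have h4 : net.nbr v p = net.nbr v q := by
      rcases Sym2.mem_iff.1 h3 with h | h
      · exact absurd h (net.adj_nbr v p).ne'
      · exact h
    apply Subtype.ext
    change s(v, _) = s(v, _)
    rw [h4]
  have h1 : ((Finset.univ.erase p).val.map (net.edge v)) =
      ((Finset.univ.erase p).image (net.edge v)).val :=
    (Finset.image_val_of_injOn (net.edge_injective v).injOn).symm
  have h2 : ((Finset.univ.erase (net.backPort v p)).val.map (net.edge (net.nbr v p))) =
      ((Finset.univ.erase (net.backPort v p)).image (net.edge (net.nbr v p))).val :=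
    (Finset.image_val_of_injOn (net.edge_injective _).injOn).symm
  rw [h1, h2, ← Finset.disjUnion_val _ _ hd]
  congr 1
  ext e
  simp only [mem_nbhd, Finset.mem_disjUnion, Finset.mem_image, Finset.mem_erase, Finset.mem_univ,
    and_true, SimpleGraph.lineGraph_adj_iff_exists]
  constructor
  · rintro ⟨hne, u, hu, hue⟩
    rcases Sym2.mem_iff.1 hu with rfl | rfl
    · left
      obtain ⟨q, rfl⟩ := net.exists_edge_eq _ e hue
      exact ⟨q, fun h => hne (by rw [h]), rfl⟩
    · right
      obtain ⟨q, rfl⟩ := net.exists_edge_eq _ e hue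
      exact ⟨q, fun h => hne (by rw [h, net.edge_backPort]), rfl⟩
  · rintro (⟨q, hq, rfl⟩ | ⟨q, hq, rfl⟩)
    · exact ⟨fun h => hq (net.edge_injective v h).symm, v, Sym2.mem_mk_left _ _,
        Sym2.mem_mk_left _ _⟩
    · refine ⟨fun h => hq ?_, net.nbr v p, Sym2.mem_mk_right _ _, Sym2.mem_mk_left _ _⟩
      apply net.edge_injective
      rw [← h, net.edge_backPort]

variable {α : Type} (start : ℕ → ℕ → Sym2 ℕ → α) (prog : ℕ → ℕ → List (LabelRule α))
  (out : α → Bool) (dflt : α)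

/-- The labels of all ports agree with a labelling of the edges. -/
def PortsLabelled (net : Network G) (N L : ℕ) (P : List (LabelRule α)) (σ : G.edgeSet → α)
    (s : ∀ v : V, PortState α (G.degree v)) : Prop :=
  ∀ v, s v = ⟨N, L, net.id v, some P, fun p => σ (net.edge v p)⟩

/-- Both endpoints of an edge evaluate the rule on the same multiset, so their two copies of its
label stay equal. -/
theorem portsLabelled_round (net : Network G) (N L : ℕ) (r : LabelRule α)
    (P : List (LabelRule α)) (σ : G.edgeSet → α) (s : ∀ v : V, PortState α (G.degree v))
    (h : PortsLabelled net N L (r :: P) σ s) :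
    PortsLabelled net N L P (applyRule G.lineGraph r σ)
      ((simulate start prog out dflt).round net s) := by
  intro v
  unfold LocalAlgorithm.round
  simp only [simulate, h v, h (net.nbr v _)]
  congr 1
  funext p
  simp only [applyRule, PortState.others]
  congr 1
  · rw [net.nbhd_edge v p, Multiset.map_add, Multiset.map_map, Multiset.map_map]
    simp only [Function.comp_def]

theorem portsLabelled_run (net : Network G) (N L t : ℕ) (P : List (LabelRule α))
    (σ : G.edgeSet → α)
    (h : PortsLabelled net N L P σ ((simulate start prog out dflt).run net N L t)) :
    PortsLabelled net N L [] (runRules G.lineGraph P σ)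
      ((simulate start prog out dflt).run net N L (t + P.length)) := by
  induction P generalizing t σ with
  | nil => exact h
  | cons r P ih =>
    have h2 := ih (t + 1) _ (portsLabelled_round start prog out dflt net N L r P σ _ h)
    rw [List.length_cons, show t + (P.length + 1) = t + 1 + P.length by ring]
    exact h2

theorem simulate_output (net : Network G) (N L : ℕ) (hL : L ≠ 0) (v : V) :
    (simulate start prog out dflt).output
      ((simulate start prog out dflt).run net N L (1 + (prog N L).length) v) =
    some fun p => out (runRules G.lineGraph (prog N L)
      (fun e => start N L (Sym2.map net.id e.1)) (net.edge v p)) := by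
  have h0 : PortsLabelled net N L (prog N L) (fun e => start N L (Sym2.map net.id e.1))
      ((simulate start prog out dflt).run net N L 1) := by
    intro v
    simp only [LocalAlgorithm.run, LocalAlgorithm.round, simulate, hL, if_false]
    rfl
  have h1 := portsLabelled_run start prog out dflt net N L 1 _ _ h0 v
  rw [h1]
  rfl

end Simulation

/-! ### Color codes from polynomials over a prime field -/

/-- `h` encodes each of the first `p ^ D` colors as a word of length `p` over an alphabet of size
`p`, so that two words agree in at most `D` places and every letter occurs at most `D` times in
every word. -/
structure IsColorCode (p D : ℕ) (h : ℕ → ℕ → ℕ) : Prop where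
  lt : ∀ c t, h c t < p
  agree : ∀ c c', c < p ^ D → c' < p ^ D → c ≠ c' →
    ((Finset.range p).filter fun t => h c t = h c' t).card ≤ D
  hit : ∀ c v, ((Finset.range p).filter fun t => h c t = v).card ≤ D

open Polynomial in
theorem card_filter_eval_zero_le {p : ℕ} [Fact p.Prime] (P : (ZMod p)[X]) (hP : P ≠ 0) :
    ((Finset.range p).filter fun t : ℕ => P.eval (t : ZMod p) = 0).card ≤ P.natDegree := by
  classical
  refine le_trans ?_ (P.card_roots')
  refine le_trans ?_ (Multiset.toFinset_card_le _)
  refine Finset.card_le_card_of_injOn (fun t => (t : ZMod p)) ?_ ?_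
  · intro t ht
    simp only [Finset.coe_filter, Set.mem_ofPred_eq] at ht
    simp [hP, ht.2]
  · intro s hs t ht hst
    simp only [Finset.coe_filter, Finset.mem_range, Set.mem_ofPred_eq] at hs ht
    have := (ZMod.natCast_eq_natCast_iff' s t p).1 hst
    rwa [Nat.mod_eq_of_lt hs.1, Nat.mod_eq_of_lt ht.1] at this

-- Colors are encoded by the values of monic polynomials of degree `D`. The difference of two of
-- them has degree below `D`, and none is constant, so root counting bounds both agreements and
-- repeated letters.
open Polynomial in
theorem exists_isColorCode {p D : ℕ} (hp : p.Prime) (hD : 0 < D) : ∃ h, IsColorCode p D h := by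
  classical
  have : Fact p.Prime := ⟨hp⟩
  have hcard : Fintype.card (Fin D → ZMod p) = p ^ D := by simp [ZMod.card]
  let enum : Fin (p ^ D) ≃ (Fin D → ZMod p) := (finCongr hcard.symm).trans (Fintype.equivFin _).symm
  have hpos : 0 < p ^ D := pow_pos hp.pos D
  let low : ℕ → (ZMod p)[X] := fun c =>
    ((degreeLTEquiv (ZMod p) D).symm (enum ⟨c % p ^ D, Nat.mod_lt _ hpos⟩) : degreeLT (ZMod p) D)
  have hlow : ∀ c, (low c).degree < D := fun c => mem_degreeLT.1 (Subtype.property _)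
  have hinj : ∀ c c', c < p ^ D → c' < p ^ D → low c = low c' → c = c' := by
    intro c c' hc hc' h
    have h1 := enum.injective ((degreeLTEquiv (ZMod p) D).symm.injective (Subtype.ext h))
    have h2 : c % p ^ D = c' % p ^ D := congrArg Fin.val h1
    rwa [Nat.mod_eq_of_lt hc, Nat.mod_eq_of_lt hc'] at h2
  have hnat : ∀ c, (low c).natDegree < D := fun c => by
    by_cases h0 : low c = 0
    · simpa [h0] using hD
    · exact (natDegree_lt_iff_degree_lt h0).2 (hlow c)
  -- The term `X ^ D` cancels in differences; its only purpose is `hit`, which would fail for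
  -- constant polynomials.
  refine ⟨fun c t => ((X ^ D + low c).eval (t : ZMod p)).val, ⟨fun c t => ZMod.val_lt _, ?_, ?_⟩⟩
  · intro c c' hc hc' hne
    have hP : low c - low c' ≠ 0 := fun h => hne (hinj c c' hc hc' (sub_eq_zero.1 h))
    refine le_trans (le_trans (le_of_eq ?_) (card_filter_eval_zero_le _ hP)) ?_
    · congr 1
      ext t
      simp [ZMod.val_injective p |>.eq_iff, sub_eq_zero]
    · exact (natDegree_sub_le _ _).trans (max_le (hnat c).le (hnat c').le)
  · intro c v
    by_cases hv : v < p
    · have hdeg : (X ^ D + low c - C (v : ZMod p)).degree = (D : WithBot ℕ) := by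
        rw [add_sub_assoc, degree_add_eq_left_of_degree_lt, degree_X_pow]
        rw [degree_X_pow]
        refine lt_of_le_of_lt (degree_sub_le _ _) (max_lt (hlow c) ?_)
        exact lt_of_le_of_lt degree_C_le (by exact_mod_cast hD)
      have hP : X ^ D + low c - C (v : ZMod p) ≠ 0 := by
        intro h
        rw [h] at hdeg
        simp at hdeg
      refine le_trans (le_trans (le_of_eq ?_) (card_filter_eval_zero_le _ hP))
        (natDegree_le_of_degree_le hdeg.le)
      congr 1
      ext t
      simp only [Finset.mem_filter, eval_sub, eval_C, sub_eq_zero]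
      refine and_congr_right fun _ => ⟨fun h => ?_, fun h => ?_⟩
      · rw [← h, ZMod.natCast_val, ZMod.cast_id]
      · rw [h, ZMod.val_natCast, Nat.mod_eq_of_lt hv]
    · rw [Finset.filter_eq_empty_iff.2]
      · simp
      · intro t _ h
        exact hv (h ▸ ZMod.val_lt _)

theorem sum_nbhd_comm {ι : Type*} [Fintype ι] {M : Type*} [AddCommMonoid M] (H : SimpleGraph ι) (F : ι → ι → M) :
    ∑ e, ∑ f ∈ nbhd H e, F e f = ∑ e, ∑ f ∈ nbhd H e, F f e := by
  refine Finset.sum_comm' ?_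
  intro x y
  simp [H.adj_comm]

/-- Weighted one-round color reduction: some place `t < p` of the code is good on average. -/
theorem exists_place_conflict_le {ι : Type*} {p D : ℕ} {h : ℕ → ℕ → ℕ} (hp : 0 < p) (hh : IsColorCode p D h)
    (S : Finset ι) (β : ι → ℝ) (hβ : ∀ f ∈ S, 0 ≤ β f) (c : ι → ℕ) (hc : ∀ f, c f < p ^ D)
    (e : ι) :
    ∃ t < p, (p : ℝ) * ∑ f ∈ S, (if c f ≠ c e ∧ h (c f) t = h (c e) t then β f else 0) ≤
      D * ∑ f ∈ S, β f := by
  by_contra! hcon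
  -- Averaging over the places: each `f` of another color agrees with `e` in at most `D` of the `p`
  -- places.
  have h1 : ∑ t ∈ Finset.range p, ((D : ℝ) * ∑ f ∈ S, β f) <
      ∑ t ∈ Finset.range p,
        (p : ℝ) * ∑ f ∈ S, (if c f ≠ c e ∧ h (c f) t = h (c e) t then β f else 0) :=
    Finset.sum_lt_sum_of_nonempty (Finset.nonempty_range_iff.2 hp.ne')
      fun t ht => hcon t (Finset.mem_range.1 ht)
  rw [Finset.sum_const, Finset.card_range, nsmul_eq_mul, ← Finset.mul_sum, Finset.sum_comm] at h1
  have hp' : (0 : ℝ) < p := by exact_mod_cast hp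
  have h2 := lt_of_mul_lt_mul_left h1 hp'.le
  refine absurd h2 (not_lt.2 ?_)
  rw [Finset.mul_sum]
  refine Finset.sum_le_sum fun f hf => ?_
  rw [← Finset.sum_filter, Finset.sum_const, nsmul_eq_mul]
  refine mul_le_mul_of_nonneg_right ?_ (hβ f hf)
  by_cases hne : c f = c e
  · simp [hne]
  · simpa [hne] using hh.agree _ _ (hc f) (hc e) hne

/-! ### Choosing time slots with few conflicts -/

section Slots

variable {ι : Type*} [Fintype ι] (H : SimpleGraph ι) (p D : ℕ) (h : ℕ → ℕ → ℕ) (c : ι → ℕ)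
  (β : ι → ι → ℝ)

/-- At time `t` node `e` is about to take the slot `h (c e) t`, which `f` has already taken or is
about to take, too. -/
def SlotConflict (s : ι → Option ℕ) (t : ℕ) (e f : ι) : Prop :=
  s f = some (h (c e) t) ∨ (s f = none ∧ c f ≠ c e ∧ h (c f) t = h (c e) t)

instance (s : ι → Option ℕ) (t : ℕ) (e f : ι) : Decidable (SlotConflict h c s t e f) := by
  unfold SlotConflict; infer_instance

/-- The slots after `t` rounds, in which every node without a slot takes the slot that its code
word proposes if the conflict weight is at most twice the average. -/
noncomputable def slots : ℕ → ι → Option ℕ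
  | 0 => fun _ => none
  | t + 1 => fun e =>
    if slots t e = none ∧
        (p : ℝ) * ∑ f ∈ nbhd H e, (if SlotConflict h c (slots t) t e f then β e f else 0) ≤
          2 * D * ∑ f ∈ nbhd H e, β e f
    then some (h (c e) t) else slots t e

variable {H p D h c β}

theorem slots_succ (t : ℕ) (e : ι) : slots H p D h c β (t + 1) e =
    if slots H p D h c β t e = none ∧
        (p : ℝ) * ∑ f ∈ nbhd H e,
          (if SlotConflict h c (slots H p D h c β t) t e f then β e f else 0) ≤
          2 * D * ∑ f ∈ nbhd H e, β e f
    then some (h (c e) t) else slots H p D h c β t e := rfl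

theorem slots_succ_of_some {t v : ℕ} {e : ι} (hs : slots H p D h c β t e = some v) :
    slots H p D h c β (t + 1) e = some v := by
  simp [slots, hs]

theorem slots_mono {t t' v : ℕ} {e : ι} (htt : t ≤ t') (hs : slots H p D h c β t e = some v) :
    slots H p D h c β t' e = some v := by
  induction t', htt using Nat.le_induction with
  | base => exact hs
  | succ n _ ih => exact slots_succ_of_some ih

theorem slots_none {t t' : ℕ} {e : ι} (htt : t ≤ t') (hs : slots H p D h c β t' e = none) :
    slots H p D h c β t e = none := by
  by_contra hne
  obtain ⟨v, hv⟩ := Option.ne_none_iff_exists'.1 hne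
  rw [slots_mono htt hv] at hs
  cases hs

theorem slots_lt (hh : IsColorCode p D h) {t v : ℕ} {e : ι}
    (hs : slots H p D h c β t e = some v) : v < p := by
  induction t with
  | zero => cases hs
  | succ t ih =>
    rw [slots_succ] at hs
    split_ifs at hs with hc
    · cases hs
      exact hh.lt _ _
    · exact ih hs

/-- If `e` refused at all `p` times, its total conflict weight would exceed `2 * D * ∑ β`. But each
neighbor conflicts with `e` at most `D` times through its final slot (`hit`) and at most `D` times
while undecided (`agree`). -/
theorem slots_ne_none (hp : 0 < p) (hh : IsColorCode p D h) (hc : ∀ f, c f < p ^ D)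
    (hβ : ∀ e f, 0 ≤ β e f) (e : ι) : slots H p D h c β p e ≠ none := by
  intro hnone
  have hnone' : ∀ t ≤ p, slots H p D h c β t e = none := fun t ht => slots_none ht hnone
  have hlt : ∀ t ∈ Finset.range p, 2 * D * ∑ f ∈ nbhd H e, β e f <
      (p : ℝ) * ∑ f ∈ nbhd H e,
        (if SlotConflict h c (slots H p D h c β t) t e f then β e f else 0) := by
    intro t ht
    by_contra! hcon
    have h1 := hnone' (t + 1) (Finset.mem_range.1 ht)
    rw [slots_succ, if_pos ⟨hnone' t (Finset.mem_range.1 ht).le, hcon⟩] at h1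
    cases h1
  have h1 := Finset.sum_lt_sum_of_nonempty (Finset.nonempty_range_iff.2 hp.ne') hlt
  rw [Finset.sum_const, Finset.card_range, nsmul_eq_mul, ← Finset.mul_sum, Finset.sum_comm] at h1
  have hp' : (0 : ℝ) < p := by exact_mod_cast hp
  have h2 := lt_of_mul_lt_mul_left h1 hp'.le
  refine absurd h2 (not_lt.2 ?_)
  rw [Finset.mul_sum]
  refine Finset.sum_le_sum fun f _ => ?_
  rw [← Finset.sum_filter, Finset.sum_const, nsmul_eq_mul]
  refine mul_le_mul_of_nonneg_right ?_ (hβ e f)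
  have hsub : ((Finset.range p).filter fun t => SlotConflict h c (slots H p D h c β t) t e f) ⊆
      ((Finset.range p).filter fun t => slots H p D h c β t f = some (h (c e) t)) ∪
      ((Finset.range p).filter fun t => c f ≠ c e ∧ h (c f) t = h (c e) t) := by
    intro t ht
    simp only [Finset.mem_union, Finset.mem_filter] at ht ⊢
    rcases ht.2 with h1 | h1
    · exact Or.inl ⟨ht.1, h1⟩
    · exact Or.inr ⟨ht.1, h1.2⟩
  have hA : ((Finset.range p).filter fun t =>
      slots H p D h c β t f = some (h (c e) t)).card ≤ D := by
    cases hf : slots H p D h c β p f with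
    | none =>
      rw [Finset.filter_eq_empty_iff.2]
      · simp
      · intro t ht h1
        rw [slots_none (Finset.mem_range.1 ht).le hf] at h1
        cases h1
    | some v =>
      refine le_trans (Finset.card_le_card ?_) (hh.hit (c e) v)
      intro t ht
      simp only [Finset.mem_filter, Finset.mem_range] at ht ⊢
      refine ⟨ht.1, ?_⟩
      have h1 := slots_mono ht.1.le ht.2
      rw [hf] at h1
      exact (Option.some.inj h1).symm
  have hB : ((Finset.range p).filter fun t => c f ≠ c e ∧ h (c f) t = h (c e) t).card ≤ D := by
    by_cases hne : c f = c e
    · simp [hne]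
    · simpa [hne] using hh.agree _ _ (hc f) (hc e) hne
  have := (Finset.card_le_card hsub).trans (Finset.card_union_le _ _)
  have h3 : ((Finset.range p).filter fun t =>
      SlotConflict h c (slots H p D h c β t) t e f).card ≤ 2 * D := by omega
  exact_mod_cast h3

/-- Few pairs of neighbors of different colors end up with the same slot. -/
theorem slots_mono_weight (hβ : ∀ e f, 0 ≤ β e f)
    (hsymm : ∀ e f, β e f = β f e) (hdone : ∀ e, slots H p D h c β p e ≠ none) :
    (p : ℝ) * ∑ e, ∑ f ∈ nbhd H e,
      (if c e ≠ c f ∧ slots H p D h c β p e = slots H p D h c β p f then β e f else 0) ≤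
    4 * D * ∑ e, ∑ f ∈ nbhd H e, β e f := by
  classical
  -- `τ e` will be the round in which `e` takes its slot.
  have htime : ∀ e, ∃ t < p, slots H p D h c β t e = none ∧
      slots H p D h c β (t + 1) e ≠ none := by
    intro e
    by_contra! hcon
    have : ∀ t ≤ p, slots H p D h c β t e = none := by
      intro t
      induction t with
      | zero => intro _; rfl
      | succ t ih => exact fun ht => hcon t ht (ih (by omega))
    exact hdone e (this p le_rfl)
  choose τ hτp hτ0 hτ1 using htime
  have hstep : ∀ e, slots H p D h c β (τ e + 1) e = some (h (c e) (τ e)) ∧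
      (p : ℝ) * ∑ f ∈ nbhd H e,
        (if SlotConflict h c (slots H p D h c β (τ e)) (τ e) e f then β e f else 0) ≤
          2 * D * ∑ f ∈ nbhd H e, β e f := by
    intro e
    have h1 := hτ1 e
    rw [slots_succ] at h1 ⊢
    split_ifs at h1 ⊢ with hif
    · exact ⟨rfl, hif.2⟩
    · exact absurd (hτ0 e) h1
  have hfin : ∀ e, slots H p D h c β p e = some (h (c e) (τ e)) := fun e =>
    slots_mono (hτp e) (hstep e).1
  set K : ι → ι → ℝ := fun e f =>
    if SlotConflict h c (slots H p D h c β (τ e)) (τ e) e f then β e f else 0 with hK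
  have hK0 : ∀ e f, 0 ≤ K e f := by
    intro e f
    simp only [hK]
    split_ifs
    · exact hβ e f
    · exact le_rfl
  -- A pair is charged to the endpoint that decides later, which saw the conflict and accepted it.
  -- Summing both orientations turns the acceptance bound `2 * D` into `4 * D`.
  have hpair : ∀ e f, (if c e ≠ c f ∧ slots H p D h c β p e = slots H p D h c β p f
      then β e f else 0) ≤ K e f + K f e := by
    intro e f
    split_ifs with hef
    · have heq : h (c e) (τ e) = h (c f) (τ f) := by
        have := hef.2
        rw [hfin e, hfin f] at this
        exact Option.some.inj this
      rcases lt_trichotomy (τ e) (τ f) with hlt | hlt | hlt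
      · have : SlotConflict h c (slots H p D h c β (τ f)) (τ f) f e := by
          left
          rw [slots_mono (Nat.succ_le_of_lt hlt) (hstep e).1, heq]
        have h2 : K f e = β e f := by simp only [hK, if_pos this, hsymm e f]
        linarith [hK0 e f]
      · have : SlotConflict h c (slots H p D h c β (τ f)) (τ f) f e := by
          right
          refine ⟨hlt ▸ hτ0 e, hef.1, ?_⟩
          rw [← heq, hlt]
        have h2 : K f e = β e f := by simp only [hK, if_pos this, hsymm e f]
        linarith [hK0 e f]
      · have : SlotConflict h c (slots H p D h c β (τ e)) (τ e) e f := by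
          left
          rw [slots_mono (Nat.succ_le_of_lt hlt) (hstep f).1, heq]
        have h2 : K e f = β e f := by simp only [hK, if_pos this]
        linarith [hK0 f e]
    · linarith [hK0 e f, hK0 f e]
  have hsum : (p : ℝ) * ∑ e, ∑ f ∈ nbhd H e, K e f ≤ 2 * D * ∑ e, ∑ f ∈ nbhd H e, β e f := by
    rw [Finset.mul_sum, Finset.mul_sum]
    exact Finset.sum_le_sum fun e _ => (hstep e).2
  have hle : ∑ e, ∑ f ∈ nbhd H e,
      (if c e ≠ c f ∧ slots H p D h c β p e = slots H p D h c β p f then β e f else 0) ≤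
      ∑ e, ∑ f ∈ nbhd H e, K e f + ∑ e, ∑ f ∈ nbhd H e, K e f := by
    calc _ ≤ ∑ e, ∑ f ∈ nbhd H e, (K e f + K f e) :=
          Finset.sum_le_sum fun e _ => Finset.sum_le_sum fun f _ => hpair e f
      _ = _ := by
          simp only [Finset.sum_add_distrib]
          rw [← sum_nbhd_comm H K]
  have := mul_le_mul_of_nonneg_left hle (Nat.cast_nonneg (α := ℝ) p)
  linarith

end Slots

/-! ### Rounding one level of values slot by slot -/

section Rounding

variable {ι : Type*} [Fintype ι] (H : SimpleGraph ι) (w : ι → ℝ)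

/-- The weight of a fractional set. -/
noncomputable def gain (x : ι → ℝ) : ℝ := ∑ e, w e * x e

/-- The conflict cost of a fractional set. -/
noncomputable def cost (x : ι → ℝ) : ℝ := ∑ e, ∑ f ∈ nbhd H e, w e * x e * x f

/-- The partial derivative of `gain - c * cost`. -/
noncomputable def gradientAt (c : ℝ) (x : ι → ℝ) (e : ι) : ℝ :=
  w e - c * ∑ f ∈ nbhd H e, (w e + w f) * x f

/-- In step `t` the nodes with slot `t` and value `v` double their value if this does not decrease
`gain - c * cost`, and give it up otherwise. -/
noncomputable def rounded (c v : ℝ) (slot : ι → Option ℕ) (x : ι → ℝ) : ℕ → ι → ℝ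
  | 0 => x
  | t + 1 => fun e =>
    if slot e = some t ∧ rounded c v slot x t e = v then
      (if 0 ≤ gradientAt H w c (rounded c v slot x t) e then 2 * v else 0)
    else rounded c v slot x t e

variable {H w}

theorem rounded_succ (c v : ℝ) (slot : ι → Option ℕ) (x : ι → ℝ) (t : ℕ) (e : ι) :
    rounded H w c v slot x (t + 1) e =
    if slot e = some t ∧ rounded H w c v slot x t e = v then
      (if 0 ≤ gradientAt H w c (rounded H w c v slot x t) e then 2 * v else 0)
    else rounded H w c v slot x t e := rfl

theorem rounded_eq_of_le {c v : ℝ} {slot : ι → Option ℕ} {x : ι → ℝ} {e : ι} {k : ℕ}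
    (hk : slot e = some k) {t : ℕ} (ht : t ≤ k) : rounded H w c v slot x t e = x e := by
  induction t with
  | zero => rfl
  | succ t ih =>
    rw [rounded_succ, if_neg, ih (by omega)]
    rw [hk]
    rintro ⟨h1, -⟩
    have := Option.some.inj h1
    omega

theorem rounded_eq_of_lt {c v : ℝ} {slot : ι → Option ℕ} {x : ι → ℝ} {e : ι} {k : ℕ}
    (hk : slot e = some k) {t : ℕ} (ht : k + 1 ≤ t) :
    rounded H w c v slot x t e = rounded H w c v slot x (k + 1) e := by
  induction t, ht using Nat.le_induction with
  | base => rfl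
  | succ t hkt ih =>
    rw [rounded_succ, if_neg, ih]
    rw [hk]
    rintro ⟨h1, -⟩
    have := Option.some.inj h1
    omega

theorem rounded_final {c v : ℝ} {slot : ι → Option ℕ} {x : ι → ℝ} {e : ι} {k p : ℕ}
    (hk : slot e = some k) (hp : k < p) :
    (x e ≠ v → rounded H w c v slot x p e = x e) ∧
    (x e = v → rounded H w c v slot x p e = 2 * v ∨ rounded H w c v slot x p e = 0) := by
  rw [rounded_eq_of_lt hk hp, rounded_succ, rounded_eq_of_le hk le_rfl]
  refine ⟨fun h => if_neg fun h1 => h h1.2, fun h => ?_⟩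
  rw [if_pos ⟨hk, h⟩]
  split_ifs
  · exact Or.inl rfl
  · exact Or.inr rfl

/-- The potential is quadratic, so its second-order Taylor expansion is exact. Without loops, the
quadratic term involves only pairs of distinct adjacent nodes that both move. -/
theorem gain_sub_cost_add (c : ℝ) (x δ : ι → ℝ) :
    gain w (x + δ) - c * cost H w (x + δ) =
      gain w x - c * cost H w x + ∑ e, gradientAt H w c x e * δ e -
        c * ∑ e, ∑ f ∈ nbhd H e, w e * δ e * δ f := by
  have h1 : cost H w (x + δ) = cost H w x + ∑ e, (∑ f ∈ nbhd H e, (w e + w f) * x f) * δ e +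
      ∑ e, ∑ f ∈ nbhd H e, w e * δ e * δ f := by
    have h2 : ∑ e, (∑ f ∈ nbhd H e, (w e + w f) * x f) * δ e =
        ∑ e, ∑ f ∈ nbhd H e, w e * δ e * x f + ∑ e, ∑ f ∈ nbhd H e, w e * x e * δ f := by
      rw [sum_nbhd_comm H (fun e f => w e * x e * δ f), ← Finset.sum_add_distrib]
      refine Finset.sum_congr rfl fun e _ => ?_
      rw [← Finset.sum_add_distrib, Finset.sum_mul]
      exact Finset.sum_congr rfl fun f _ => by ring
    rw [h2]
    simp only [cost, ← Finset.sum_add_distrib]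
    refine Finset.sum_congr rfl fun e _ => Finset.sum_congr rfl fun f _ => ?_
    simp only [Pi.add_apply]
    ring
  have h3 : gain w (x + δ) = gain w x + ∑ e, w e * δ e := by
    simp only [gain, ← Finset.sum_add_distrib, Pi.add_apply, mul_add]
  have h4 : ∑ e, gradientAt H w c x e * δ e =
      ∑ e, w e * δ e - c * ∑ e, (∑ f ∈ nbhd H e, (w e + w f) * x f) * δ e := by
    rw [Finset.mul_sum, ← Finset.sum_sub_distrib]
    refine Finset.sum_congr rfl fun e _ => ?_
    simp only [gradientAt]
    ring
  rw [h1, h3, h4]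
  ring

/-- The loss of one step comes only from pairs of neighbors with the same slot. -/
theorem rounded_step {c v : ℝ} (hc : 0 ≤ c) (hv : 0 ≤ v) (hw : ∀ e, 0 ≤ w e)
    (slot : ι → Option ℕ) (x : ι → ℝ) (hx : ∀ e, 0 ≤ x e) (t : ℕ) :
    gain w (rounded H w c v slot x t) - c * cost H w (rounded H w c v slot x t) -
      c * ∑ e, ∑ f ∈ nbhd H e,
        (if slot e = some t ∧ slot f = some t then w e * x e * x f else 0) ≤
    gain w (rounded H w c v slot x (t + 1)) - c * cost H w (rounded H w c v slot x (t + 1)) := by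
  set y := rounded H w c v slot x t with hy
  set δ : ι → ℝ := rounded H w c v slot x (t + 1) - y with hδ
  -- Nodes with slot `t` have not moved before step `t`, so the loss can be measured in the original
  -- values.
  have hyx : ∀ e, slot e = some t → y e = x e := fun e he => rounded_eq_of_le he le_rfl
  have hδe : ∀ e, δ e = if slot e = some t ∧ y e = v then
      (if 0 ≤ gradientAt H w c y e then v else -v) else 0 := by
    intro e
    simp only [hδ, Pi.sub_apply, rounded_succ, ← hy]
    split_ifs with h1 h2
    · rw [h1.2]; ring
    · rw [h1.2]; ring
    · ring
  have habs : ∀ e, |δ e| ≤ if slot e = some t then x e else 0 := by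
    intro e
    rw [hδe]
    by_cases h1 : slot e = some t
    · rw [if_pos h1]
      by_cases h2 : y e = v
      · rw [if_pos ⟨h1, h2⟩, ← hyx e h1, h2]
        split_ifs
        · rw [abs_of_nonneg hv]
        · rw [abs_neg, abs_of_nonneg hv]
      · rw [if_neg fun h => h2 h.2, abs_zero]
        exact hx e
    · rw [if_neg fun h => h1 h.1, if_neg h1, abs_zero]
  have hsucc : rounded H w c v slot x (t + 1) = y + δ := by rw [hδ]; abel
  rw [hsucc, gain_sub_cost_add]
  -- Doubling and deleting move a value by `v` and `-v`; the sign of the derivative decides between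
  -- them, so the linear term never loses.
  have hpos : 0 ≤ ∑ e, gradientAt H w c y e * δ e := by
    refine Finset.sum_nonneg fun e _ => ?_
    rw [hδe]
    split_ifs with h1 h2
    · exact mul_nonneg h2 hv
    · nlinarith
    · simp
  have herr : ∑ e, ∑ f ∈ nbhd H e, w e * δ e * δ f ≤ ∑ e, ∑ f ∈ nbhd H e,
        (if slot e = some t ∧ slot f = some t then w e * x e * x f else 0) := by
    refine Finset.sum_le_sum fun e _ => Finset.sum_le_sum fun f _ => ?_
    have h1 : δ e * δ f ≤ (if slot e = some t then x e else 0) *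
        (if slot f = some t then x f else 0) := by
      refine (le_abs_self _).trans ?_
      rw [abs_mul]
      exact mul_le_mul (habs e) (habs f) (abs_nonneg _) ((abs_nonneg _).trans (habs e))
    have h2 := mul_le_mul_of_nonneg_left h1 (hw e)
    have h3 : w e * ((if slot e = some t then x e else 0) * (if slot f = some t then x f else 0)) =
        if slot e = some t ∧ slot f = some t then w e * x e * x f else 0 := by
      by_cases ha : slot e = some t <;> by_cases hb : slot f = some t <;> simp [ha, hb] <;> ring
    rw [← h3]
    linarith
  have := mul_le_mul_of_nonneg_left herr hc
  linarith

theorem rounded_gain_sub_cost {c v : ℝ} (hc : 0 ≤ c) (hv : 0 ≤ v) (hw : ∀ e, 0 ≤ w e)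
    (slot : ι → Option ℕ) (x : ι → ℝ) (hx : ∀ e, 0 ≤ x e) (p : ℕ) :
    gain w x - c * cost H w x - c * ∑ e, ∑ f ∈ nbhd H e,
        (if slot e = slot f then w e * x e * x f else 0) ≤
    gain w (rounded H w c v slot x p) - c * cost H w (rounded H w c v slot x p) := by
  have h1 : ∀ p, gain w x - c * cost H w x - c * ∑ t ∈ Finset.range p, ∑ e, ∑ f ∈ nbhd H e,
        (if slot e = some t ∧ slot f = some t then w e * x e * x f else 0) ≤
      gain w (rounded H w c v slot x p) - c * cost H w (rounded H w c v slot x p) := by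
    intro p
    induction p with
    | zero => simp [rounded]
    | succ p ih =>
      rw [Finset.sum_range_succ, mul_add]
      linarith [rounded_step (H := H) hc hv hw slot x hx p]
  refine le_trans ?_ (h1 p)
  -- A pair in a common slot is charged in at most one step.
  have h2 : ∑ t ∈ Finset.range p, ∑ e, ∑ f ∈ nbhd H e,
        (if slot e = some t ∧ slot f = some t then w e * x e * x f else 0) ≤
      ∑ e, ∑ f ∈ nbhd H e, (if slot e = slot f then w e * x e * x f else 0) := by
    rw [Finset.sum_comm]
    refine Finset.sum_le_sum fun e _ => ?_
    rw [Finset.sum_comm]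
    refine Finset.sum_le_sum fun f _ => ?_
    have h0 : 0 ≤ w e * x e * x f := mul_nonneg (mul_nonneg (hw e) (hx e)) (hx f)
    cases he : slot e with
    | none => simp; split_ifs <;> simp [h0]
    | some k =>
      by_cases hf : slot f = some k
      · rw [if_pos hf.symm]
        have : ∀ t, (if some k = some t ∧ slot f = some t then w e * x e * x f else 0) =
            if k = t then w e * x e * x f else 0 := by
          intro t
          by_cases hkt : k = t
          · subst hkt; simp [hf]
          · simp [hkt]
        simp only [this, Finset.sum_ite_eq]
        split_ifs
        · exact le_rfl
        · exact h0
      · rw [if_neg fun h => hf h.symm]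
        refine le_of_eq (Finset.sum_eq_zero fun t _ => if_neg ?_)
        rintro ⟨h3, h4⟩
        exact hf (h4.trans h3.symm)
  have := mul_le_mul_of_nonneg_left h2 hc
  linarith

end Rounding

/-! ### Labels and rules for the independent set algorithm -/

/-- The label of a node in the maximal independent set algorithm. -/
structure NodeLabel where
  /-- the color in a proper coloring -/
  base : ℕ
  /-- the color in a coloring with few monochromatic pairs -/
  lev : ℕ
  /-- the time at which the node is rounded -/
  slot : Option ℕ
  /-- the weight in the current phase -/
  wt : ℝ
  /-- the fractional value -/
  val : ℝ
  /-- neither selected nor adjacent to a selected node -/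
  alive : Bool
  /-- selected for the independent set -/
  sel : Bool

namespace NodeLabel

/-- The weight of the pair of two nodes in the conflict cost. -/
def pairWeight (a s : NodeLabel) : ℝ := (a.wt + s.wt) * (a.val * s.val)

/-- A place of the code word where the weight of the agreeing neighbors is at most average. -/
noncomputable def place (p D : ℕ) (h : ℕ → ℕ → ℕ) (β : NodeLabel → NodeLabel → ℝ) (a : NodeLabel)
    (S : Multiset NodeLabel) : ℕ :=
  sInf {t | t < p ∧ (p : ℝ) * (S.map fun s =>
    if s.base ≠ a.base ∧ h s.base t = h a.base t then β a s else 0).sum ≤ D * (S.map (β a)).sum}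

/-- The color that consists of a place and of the letter at this place. -/
noncomputable def newColor (p D : ℕ) (h : ℕ → ℕ → ℕ) (β : NodeLabel → NodeLabel → ℝ)
    (a : NodeLabel) (S : Multiset NodeLabel) : ℕ :=
  place p D h β a S * p + h a.base (place p D h β a S)

/-- Reduce the number of colors of a proper coloring. -/
noncomputable def properRule (p D : ℕ) (h : ℕ → ℕ → ℕ) : LabelRule NodeLabel := fun a S =>
  { a with base := newColor p D h (fun _ _ => 1) a S }

/-- Compute a coloring with few colors and few monochromatic pairs. -/
noncomputable def recolorRule (p D : ℕ) (h : ℕ → ℕ → ℕ) : LabelRule NodeLabel := fun a S =>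
  { a with lev := newColor p D h pairWeight a S, slot := none }

/-- Take the slot that the code word proposes at time `t`, unless this causes many conflicts. -/
noncomputable def slotRule (p D : ℕ) (h : ℕ → ℕ → ℕ) (t : ℕ) : LabelRule NodeLabel := fun a S =>
  { a with slot :=
      if a.slot = none ∧ (p : ℝ) * (S.map fun s =>
        if s.slot = some (h a.lev t) ∨ (s.slot = none ∧ s.lev ≠ a.lev ∧ h s.lev t = h a.lev t)
          then pairWeight a s else 0).sum ≤ 2 * D * (S.map (pairWeight a)).sum
      then some (h a.lev t) else a.slot }

/-- Round the values equal to `v` of the nodes with slot `t`. -/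
noncomputable def roundRule (c v : ℝ) (t : ℕ) : LabelRule NodeLabel := fun a S =>
  { a with val :=
      if a.slot = some t ∧ a.val = v then
        (if 0 ≤ a.wt - c * (S.map fun s => (a.wt + s.wt) * s.val).sum then 2 * v else 0)
      else a.val }

end NodeLabel

open NodeLabel

/-- The labels contain a proper coloring with `m` colors. -/
structure ProperBase {ι : Type*} (H : SimpleGraph ι) (m : ℕ) (σ : ι → NodeLabel) : Prop where
  lt : ∀ e, (σ e).base < m
  ne : ∀ e f, H.Adj e f → (σ e).base ≠ (σ f).base

theorem ProperBase.congr {ι : Type*} {H : SimpleGraph ι} {m : ℕ} {σ σ' : ι → NodeLabel} (hσ : ProperBase H m σ)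
    (hbase : ∀ e, (σ' e).base = (σ e).base) : ProperBase H m σ' :=
  ⟨fun e => by rw [hbase]; exact hσ.lt e, fun e f hef => by rw [hbase, hbase]; exact hσ.ne e f hef⟩

/-! ### One rounding level carried out by rules -/

section Level

variable {ι : Type*} [Fintype ι] {H : SimpleGraph ι} {p D : ℕ} {h : ℕ → ℕ → ℕ}

/-- Averaging makes the set in `place` nonempty, so its infimum is a member and not the default `0`.
-/
theorem place_spec (hp : 0 < p) (hh : IsColorCode p D h) (β : NodeLabel → NodeLabel → ℝ)
    (σ : ι → NodeLabel) (hβ : ∀ e f, 0 ≤ β (σ e) (σ f)) (hσ : ∀ e, (σ e).base < p ^ D) (e : ι) :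
    place p D h β (σ e) ((nbhd H e).val.map σ) < p ∧
    (p : ℝ) * ∑ f ∈ nbhd H e, (if (σ f).base ≠ (σ e).base ∧
        h (σ f).base (place p D h β (σ e) ((nbhd H e).val.map σ)) =
        h (σ e).base (place p D h β (σ e) ((nbhd H e).val.map σ)) then β (σ e) (σ f) else 0) ≤
      D * ∑ f ∈ nbhd H e, β (σ e) (σ f) := by
  obtain ⟨t, ht, hle⟩ := exists_place_conflict_le hp hh (nbhd H e) (fun f => β (σ e) (σ f))
    (fun f _ => hβ e f) (fun f => (σ f).base) hσ e
  have hne : {t | t < p ∧ (p : ℝ) * (((nbhd H e).val.map σ).map fun s =>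
      if s.base ≠ (σ e).base ∧ h s.base t = h (σ e).base t then β (σ e) s else 0).sum ≤
      D * (((nbhd H e).val.map σ).map (β (σ e))).sum}.Nonempty := by
    refine ⟨t, ht, ?_⟩
    rw [sum_map_nbhd, sum_map_nbhd]
    exact hle
  have hmem := Nat.sInf_mem hne
  change place p D h β (σ e) ((nbhd H e).val.map σ) ∈ _ at hmem
  refine ⟨hmem.1, ?_⟩
  have h2 := hmem.2
  rw [sum_map_nbhd, sum_map_nbhd] at h2
  exact h2

theorem newColor_lt (hp : 0 < p) (hh : IsColorCode p D h) (β : NodeLabel → NodeLabel → ℝ)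
    (σ : ι → NodeLabel) (hβ : ∀ e f, 0 ≤ β (σ e) (σ f)) (hσ : ∀ e, (σ e).base < p ^ D) (e : ι) :
    newColor p D h β (σ e) ((nbhd H e).val.map σ) < p * p := by
  have h1 := (place_spec (H := H) hp hh β σ hβ hσ e).1
  have h2 := hh.lt (σ e).base (place p D h β (σ e) ((nbhd H e).val.map σ))
  unfold newColor
  nlinarith

/-- The pairs of neighbors whose new colors coincide have small weight. -/
theorem newColor_mono (hp : 0 < p) (hh : IsColorCode p D h) (β : NodeLabel → NodeLabel → ℝ)
    (σ : ι → NodeLabel) (hβ : ∀ e f, 0 ≤ β (σ e) (σ f)) (hσ : ProperBase H (p ^ D) σ) (e : ι) :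
    (p : ℝ) * ∑ f ∈ nbhd H e, (if newColor p D h β (σ e) ((nbhd H e).val.map σ) =
        newColor p D h β (σ f) ((nbhd H f).val.map σ) then β (σ e) (σ f) else 0) ≤
      D * ∑ f ∈ nbhd H e, β (σ e) (σ f) := by
  refine le_trans ?_ (place_spec (H := H) hp hh β σ hβ hσ.lt e).2
  refine mul_le_mul_of_nonneg_left (Finset.sum_le_sum fun f hf => ?_) (Nat.cast_nonneg _)
  rw [mem_nbhd] at hf
  split_ifs with h1 h2 h2
  · exact le_rfl
  · refine absurd ⟨(hσ.ne e f hf).symm, ?_⟩ h2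
    unfold newColor at h1
    set a := place p D h β (σ e) ((nbhd H e).val.map σ)
    set b := place p D h β (σ f) ((nbhd H f).val.map σ)
    have ha := hh.lt (σ e).base a
    have hb := hh.lt (σ f).base b
    -- Place and letter are recovered as quotient and remainder modulo `p`, since letters are below
    -- `p`.
    have hab : a = b := by
      have h3 := congrArg (· / p) h1
      simpa [Nat.mul_add_div hp, mul_comm _ p, Nat.div_eq_of_lt, ha, hb] using h3
    rw [← hab] at h1
    omega
  · exact hβ e f
  · exact le_rfl

theorem runRules_slotRule (t : ℕ) (σ : ι → NodeLabel) (hσ : ∀ e, (σ e).slot = none) :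
    runRules H ((List.range t).map (slotRule p D h)) σ = fun e => { σ e with
      slot := slots H p D h (fun e => (σ e).lev) (fun e f => pairWeight (σ e) (σ f)) t e } := by
  induction t with
  | zero =>
    funext e
    change σ e = _
    simp only [slots, ← hσ e]
  | succ t ih =>
    rw [List.range_succ, List.map_append, runRules_append, ih]
    funext e
    simp only [List.map_cons, List.map_nil, runRules, applyRule, slotRule]
    congr 1
    rw [slots_succ, sum_map_nbhd, sum_map_nbhd]
    rfl

theorem runRules_roundRule (c v : ℝ) (t : ℕ) (σ : ι → NodeLabel) :
    runRules H ((List.range t).map (roundRule c v)) σ = fun e => { σ e with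
      val := rounded H (fun e => (σ e).wt) c v (fun e => (σ e).slot) (fun e => (σ e).val) t e } := by
  induction t with
  | zero => rfl
  | succ t ih =>
    rw [List.range_succ, List.map_append, runRules_append, ih]
    funext e
    simp only [List.map_cons, List.map_nil, runRules, applyRule, roundRule]
    congr 1
    rw [rounded_succ, sum_map_nbhd]
    rfl

theorem sum_pairWeight (w x : ι → ℝ) (P : ι → ι → Prop) [∀ e f, Decidable (P e f)]
    (hP : ∀ e f, P e f ↔ P f e) :
    ∑ e, ∑ f ∈ nbhd H e, (if P e f then (w e + w f) * (x e * x f) else 0) =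
      2 * ∑ e, ∑ f ∈ nbhd H e, (if P e f then w e * x e * x f else 0) := by
  rw [two_mul]
  conv_rhs =>
    arg 2
    rw [sum_nbhd_comm]
  simp only [← Finset.sum_add_distrib]
  refine Finset.sum_congr rfl fun e _ => Finset.sum_congr rfl fun f _ => ?_
  by_cases hef : P e f
  · rw [if_pos hef, if_pos hef, if_pos ((hP e f).1 hef)]; ring
  · rw [if_neg hef, if_neg hef, if_neg fun h => hef ((hP e f).2 h)]; ring

/-- The rules that round all values `v` up to `2 * v` or down to `0`. -/
noncomputable def levelRules (p₁ D₁ : ℕ) (h₁ : ℕ → ℕ → ℕ) (p₂ D₂ : ℕ) (h₂ : ℕ → ℕ → ℕ) (c v : ℝ) :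
    List (LabelRule NodeLabel) :=
  recolorRule p₁ D₁ h₁ ::
    ((List.range p₂).map (slotRule p₂ D₂ h₂) ++ (List.range p₂).map (roundRule c v))

/-- The loss is `c` times the cost of pairs in a common slot. Such a pair either has equal colors
after recoloring, which accounts for the fraction `D₁ / p₁`, or was accepted as a slot conflict,
which accounts for `4 * D₂ / p₂`. -/
theorem levelRules_spec {p₁ D₁ : ℕ} {h₁ : ℕ → ℕ → ℕ} {p₂ D₂ : ℕ} {h₂ : ℕ → ℕ → ℕ} {c v : ℝ}
    (hp₁ : 0 < p₁) (hp₂ : 0 < p₂) (hh₁ : IsColorCode p₁ D₁ h₁) (hh₂ : IsColorCode p₂ D₂ h₂)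
    (hpp : p₁ * p₁ ≤ p₂ ^ D₂) (hc : 0 ≤ c) (hv : 0 ≤ v) (σ : ι → NodeLabel)
    (hσ : ProperBase H (p₁ ^ D₁) σ) (hw : ∀ e, 0 ≤ (σ e).wt) (hx : ∀ e, 0 ≤ (σ e).val) :
    ∃ y : ι → ℝ,
      (∀ e, ((σ e).val ≠ v → y e = (σ e).val) ∧ ((σ e).val = v → y e = 2 * v ∨ y e = 0)) ∧
      gain (fun e => (σ e).wt) (fun e => (σ e).val) -
        c * (1 + (D₁ / p₁ + 4 * D₂ / p₂)) * cost H (fun e => (σ e).wt) (fun e => (σ e).val) ≤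
        gain (fun e => (σ e).wt) y - c * cost H (fun e => (σ e).wt) y ∧
      ∃ (lev : ι → ℕ) (slot : ι → Option ℕ),
        runRules H (levelRules p₁ D₁ h₁ p₂ D₂ h₂ c v) σ =
          fun e => { σ e with lev := lev e, slot := slot e, val := y e } := by
  set lev : ι → ℕ := fun e => newColor p₁ D₁ h₁ pairWeight (σ e) ((nbhd H e).val.map σ) with hlev
  set w : ι → ℝ := fun e => (σ e).wt with hw_def
  set x : ι → ℝ := fun e => (σ e).val with hx_def
  set β : ι → ι → ℝ := fun e f => (w e + w f) * (x e * x f) with hβ_def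
  set slot : ι → Option ℕ := slots H p₂ D₂ h₂ lev β p₂ with hslot
  have hβ : ∀ e f, 0 ≤ β e f := fun e f =>
    mul_nonneg (add_nonneg (hw e) (hw f)) (mul_nonneg (hx e) (hx f))
  have hβs : ∀ e f, β e f = β f e := fun e f => by simp only [hβ_def]; ring
  have hlevlt : ∀ e, lev e < p₂ ^ D₂ := fun e =>
    lt_of_lt_of_le (newColor_lt hp₁ hh₁ pairWeight σ hβ hσ.lt e) hpp
  have hne := slots_ne_none (H := H) hp₂ hh₂ hlevlt hβ
  refine ⟨rounded H w c v slot x p₂, ?_, ?_, lev, slot, ?_⟩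
  · intro e
    obtain ⟨k, hk⟩ := Option.ne_none_iff_exists'.1 (hne e)
    exact rounded_final (H := H) (w := w) (c := c) (x := x) (slot := slot) hk (slots_lt hh₂ hk)
  · refine le_trans ?_ (rounded_gain_sub_cost hc hv hw slot x hx p₂)
    have hm1 : (p₁ : ℝ) * ∑ e, ∑ f ∈ nbhd H e, (if lev e = lev f then β e f else 0) ≤
        D₁ * ∑ e, ∑ f ∈ nbhd H e, β e f := by
      rw [Finset.mul_sum, Finset.mul_sum]
      exact Finset.sum_le_sum fun e _ => newColor_mono hp₁ hh₁ pairWeight σ hβ hσ e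
    have hm2 := slots_mono_weight (H := H) (h := h₂) (c := lev) hβ hβs hne
    have hm : ∑ e, ∑ f ∈ nbhd H e, (if slot e = slot f then β e f else 0) ≤
        ∑ e, ∑ f ∈ nbhd H e, (if lev e = lev f then β e f else 0) +
        ∑ e, ∑ f ∈ nbhd H e, (if lev e ≠ lev f ∧ slot e = slot f then β e f else 0) := by
      simp only [← Finset.sum_add_distrib]
      refine Finset.sum_le_sum fun e _ => Finset.sum_le_sum fun f _ => ?_
      have := hβ e f
      by_cases ha : slot e = slot f <;> by_cases hb : lev e = lev f <;> simp [ha, hb, this]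
    have hcost : ∑ e, ∑ f ∈ nbhd H e, β e f = 2 * cost H w x := by
      have := sum_pairWeight (H := H) w x (fun _ _ => True) (fun _ _ => Iff.rfl)
      simpa [cost, hβ_def] using this
    have hmono := sum_pairWeight (H := H) w x (fun e f => slot e = slot f) (fun _ _ => eq_comm)
    have hp₁' : (0 : ℝ) < p₁ := by exact_mod_cast hp₁
    have hp₂' : (0 : ℝ) < p₂ := by exact_mod_cast hp₂
    rw [hcost] at hm1 hm2
    have e1 : ∑ e, ∑ f ∈ nbhd H e, (if lev e = lev f then β e f else 0) ≤
        D₁ / p₁ * (2 * cost H w x) := by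
      rw [div_mul_eq_mul_div, le_div_iff₀ hp₁']; linarith
    have e2 : ∑ e, ∑ f ∈ nbhd H e, (if lev e ≠ lev f ∧ slot e = slot f then β e f else 0) ≤
        4 * D₂ / p₂ * (2 * cost H w x) := by
      rw [div_mul_eq_mul_div, le_div_iff₀ hp₂']; linarith
    have e3 : ∑ e, ∑ f ∈ nbhd H e, (if slot e = slot f then w e * x e * x f else 0) ≤
        (D₁ / p₁ + 4 * D₂ / p₂) * cost H w x := by
      have : 2 * ∑ e, ∑ f ∈ nbhd H e, (if slot e = slot f then w e * x e * x f else 0) ≤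
        2 * ((D₁ / p₁ + 4 * D₂ / p₂) * cost H w x) := by
        rw [← hmono]
        linarith
      linarith
    have := mul_le_mul_of_nonneg_left e3 hc
    linarith
  · rw [levelRules, runRules, runRules_append, runRules_slotRule, runRules_roundRule]
    · rfl
    · intro e
      rfl

end Level

namespace NodeLabel

/-- One more than the number of neighbors that are alive. -/
def aliveDegree (S : Multiset NodeLabel) : ℕ :=
  (S.map fun s => if s.alive then 1 else 0).sum + 1

/-- Start a phase: every node that is alive gets its degree as its weight, and a value of about the
inverse of the degree. -/
noncomputable def startRule : LabelRule NodeLabel := fun a S =>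
  { a with
    wt := if a.alive then (aliveDegree S : ℝ) else 0
    val := if a.alive then (1 / 2 : ℝ) ^ Nat.clog 2 (8 * aliveDegree S) else 0 }

open Classical in
/-- Select the nodes with value one none of whose neighbors has value one. -/
noncomputable def selectRule : LabelRule NodeLabel := fun a S =>
  { a with sel := a.sel || decide (a.val = 1 ∧ ∀ s ∈ S, s.val ≠ 1) }

open Classical in
/-- The nodes that are selected or have a selected neighbor leave. -/
noncomputable def leaveRule : LabelRule NodeLabel := fun a S =>
  { a with alive := decide (a.sel = false ∧ ∀ s ∈ S, s.sel = false) }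

end NodeLabel

open NodeLabel

/-! ### Iterating the levels down to integral values -/

section Levels

variable {ι : Type*} [Fintype ι] {H : SimpleGraph ι}

/-- Round all values `(1 / 2) ^ k` with `k ≤ i` to zero or one. -/
noncomputable def roundingRules (p₁ D₁ : ℕ) (h₁ : ℕ → ℕ → ℕ) (p₂ D₂ : ℕ) (h₂ : ℕ → ℕ → ℕ) (η : ℝ) :
    ℕ → List (LabelRule NodeLabel)
  | 0 => []
  | i + 1 => levelRules p₁ D₁ h₁ p₂ D₂ h₂ ((1 + η) ^ i) ((1 / 2) ^ (i + 1)) ++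
      roundingRules p₁ D₁ h₁ p₂ D₂ h₂ η i

theorem length_roundingRules (p₁ D₁ : ℕ) (h₁ : ℕ → ℕ → ℕ) (p₂ D₂ : ℕ) (h₂ : ℕ → ℕ → ℕ) (η : ℝ)
    (i : ℕ) : (roundingRules p₁ D₁ h₁ p₂ D₂ h₂ η i).length = i * (2 * p₂ + 1) := by
  induction i with
  | zero => simp [roundingRules]
  | succ i ih =>
    simp only [roundingRules, levelRules, List.length_append, List.length_cons, List.length_map,
      List.length_range, ih]
    ring

theorem cost_nonneg {w x : ι → ℝ} (hw : ∀ e, 0 ≤ w e) (hx : ∀ e, 0 ≤ x e) : 0 ≤ cost H w x :=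
  Finset.sum_nonneg fun e _ => Finset.sum_nonneg fun f _ =>
    mul_nonneg (mul_nonneg (hw e) (hx e)) (hx f)

/-- The smallest possible value is treated first; doubling merges it into the next level. The
conflict coefficient drops by the factor `1 + η` per level, which absorbs that level's loss, and is
1 at the end. -/
theorem roundingRules_spec {p₁ D₁ : ℕ} {h₁ : ℕ → ℕ → ℕ} {p₂ D₂ : ℕ} {h₂ : ℕ → ℕ → ℕ} {η : ℝ}
    (hp₁ : 0 < p₁) (hp₂ : 0 < p₂) (hh₁ : IsColorCode p₁ D₁ h₁) (hh₂ : IsColorCode p₂ D₂ h₂)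
    (hpp : p₁ * p₁ ≤ p₂ ^ D₂) (hη : (D₁ / p₁ + 4 * D₂ / p₂ : ℝ) ≤ η) (i : ℕ) (σ : ι → NodeLabel)
    (hσ : ProperBase H (p₁ ^ D₁) σ) (hw : ∀ e, 0 ≤ (σ e).wt)
    (hx : ∀ e, (σ e).val = 0 ∨ ∃ k ≤ i, (σ e).val = (1 / 2) ^ k) :
    ∃ y : ι → ℝ, (∀ e, y e = 0 ∨ y e = 1) ∧ (∀ e, (σ e).val = 0 → y e = 0) ∧
      gain (fun e => (σ e).wt) (fun e => (σ e).val) -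
        (1 + η) ^ i * cost H (fun e => (σ e).wt) (fun e => (σ e).val) ≤
        gain (fun e => (σ e).wt) y - cost H (fun e => (σ e).wt) y ∧
      ∃ (lev : ι → ℕ) (slot : ι → Option ℕ),
        runRules H (roundingRules p₁ D₁ h₁ p₂ D₂ h₂ η i) σ =
          fun e => { σ e with lev := lev e, slot := slot e, val := y e } := by
  have hη0 : 0 ≤ η := le_trans (by positivity) hη
  induction i generalizing σ with
  | zero =>
    refine ⟨fun e => (σ e).val, fun e => ?_, fun e he => he, by simp, fun e => (σ e).lev,
      fun e => (σ e).slot, rfl⟩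
    rcases hx e with h | ⟨k, hk, h⟩
    · exact Or.inl h
    · right
      change (σ e).val = 1
      rw [h, Nat.le_zero.1 hk, pow_zero]
  | succ i ih =>
    have hx0 : ∀ e, 0 ≤ (σ e).val := by
      intro e
      rcases hx e with h | ⟨k, hk, h⟩
      · rw [h]
      · rw [h]; positivity
    obtain ⟨y, hy, hgain, lev, slot, hrun⟩ := levelRules_spec (c := (1 + η) ^ i)
      (v := (1 / 2) ^ (i + 1)) hp₁ hp₂ hh₁ hh₂ hpp (by positivity) (by positivity) σ hσ hw hx0
    have hv : (0 : ℝ) < (1 / 2) ^ (i + 1) := by positivity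
    have hy' : ∀ e, y e = 0 ∨ ∃ k ≤ i, y e = (1 / 2) ^ k := by
      intro e
      by_cases he : (σ e).val = (1 / 2) ^ (i + 1)
      · rcases (hy e).2 he with h | h
        · right
          exact ⟨i, le_rfl, by rw [h, pow_succ]; ring⟩
        · exact Or.inl h
      · rw [(hy e).1 he]
        rcases hx e with h | ⟨k, hk, h⟩
        · exact Or.inl h
        · right
          refine ⟨k, ?_, h⟩
          rcases Nat.lt_or_ge i k with hik | hik
          · exact absurd (by rw [h, le_antisymm hk hik]) he
          · exact hik
    obtain ⟨z, hz, hz0, hgain', lev', slot', hrun'⟩ :=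
      ih (fun e => { σ e with lev := lev e, slot := slot e, val := y e })
        (hσ.congr fun _ => rfl) hw hy'
    refine ⟨z, hz, ?_, ?_, lev', slot', ?_⟩
    · intro e he
      apply hz0
      change y e = 0
      rw [(hy e).1 (by rw [he]; exact hv.ne), he]
    · refine le_trans ?_ hgain'
      refine le_trans ?_ hgain
      have hc := cost_nonneg (H := H) hw hx0
      have h1 : (1 + η) ^ i * (1 + (D₁ / p₁ + 4 * D₂ / p₂ : ℝ)) ≤ (1 + η) ^ (i + 1) := by
        rw [pow_succ]
        exact mul_le_mul_of_nonneg_left (by linarith) (by positivity)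
      have := mul_le_mul_of_nonneg_right h1 hc
      linarith
    · rw [roundingRules, runRules_append, hrun, hrun']

end Levels

/-! ### One phase removes a constant fraction of the nodes -/

section Phase

variable {ι : Type*} [Fintype ι] {H : SimpleGraph ι}

/-- The closed neighborhood of every node is covered by two cliques through the node. -/
def TwoCliqueNbhds {ι : Type*} (H : SimpleGraph ι) : Prop :=
  ∀ e, ∃ C₁ C₂ : Finset ι, H.IsClique C₁ ∧ H.IsClique C₂ ∧ e ∈ C₁ ∧
    ∀ f, H.Adj e f → f ∈ C₁ ∨ f ∈ C₂

/-- The selected nodes are independent, and the nodes alive are those which could be added. -/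
structure SelectionInv {ι : Type*} (H : SimpleGraph ι) (σ : ι → NodeLabel) : Prop where
  indep : ∀ e f, (σ e).sel = true → (σ f).sel = true → ¬ H.Adj e f
  alive_iff : ∀ e, (σ e).alive = true ↔ (σ e).sel = false ∧ ∀ f, H.Adj e f → (σ f).sel = false

/-- The nodes alive. -/
def aliveSet (σ : ι → NodeLabel) : Finset ι := Finset.univ.filter fun e => (σ e).alive = true

@[simp] theorem mem_aliveSet {σ : ι → NodeLabel} {e : ι} :
    e ∈ aliveSet σ ↔ (σ e).alive = true := by simp [aliveSet]

/-- The degree of a node in the graph of the nodes alive, plus one. -/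
noncomputable def aliveDeg (H : SimpleGraph ι) (σ : ι → NodeLabel) (e : ι) : ℕ :=
  aliveDegree ((nbhd H e).val.map σ)

theorem aliveDeg_eq (σ : ι → NodeLabel) (e : ι) :
    aliveDeg H σ e = ((nbhd H e).filter fun f => (σ f).alive = true).card + 1 := by
  rw [aliveDeg, aliveDegree, sum_map_nbhd, Finset.card_filter]

/-- The value given to a node at the start of a phase. -/
noncomputable def startVal (H : SimpleGraph ι) (σ : ι → NodeLabel) (e : ι) : ℝ :=
  if (σ e).alive then (1 / 2 : ℝ) ^ Nat.clog 2 (8 * aliveDeg H σ e) else 0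

/-- The weight given to a node at the start of a phase. -/
noncomputable def startWt (H : SimpleGraph ι) (σ : ι → NodeLabel) (e : ι) : ℝ :=
  if (σ e).alive then (aliveDeg H σ e : ℝ) else 0

theorem startVal_nonneg (σ : ι → NodeLabel) (e : ι) : 0 ≤ startVal H σ e := by
  unfold startVal; split_ifs <;> positivity

theorem startWt_nonneg (σ : ι → NodeLabel) (e : ι) : 0 ≤ startWt H σ e := by
  unfold startWt; split_ifs <;> positivity

theorem startVal_le (σ : ι → NodeLabel) (e : ι) : startVal H σ e ≤ 1 / (8 * aliveDeg H σ e) := by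
  unfold startVal
  split_ifs
  · have h1 : 8 * aliveDeg H σ e ≤ 2 ^ Nat.clog 2 (8 * aliveDeg H σ e) :=
      Nat.le_pow_clog one_lt_two _
    have h2 : (8 * aliveDeg H σ e : ℝ) ≤ 2 ^ Nat.clog 2 (8 * aliveDeg H σ e) := by
      exact_mod_cast h1
    have h3 : (0 : ℝ) < aliveDeg H σ e := by rw [aliveDeg_eq]; positivity
    rw [one_div_pow]
    exact one_div_le_one_div_of_le (by positivity) h2
  · positivity

theorem le_startWt_mul_startVal (σ : ι → NodeLabel) (e : ι) (he : (σ e).alive = true) :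
    1 / 16 ≤ startWt H σ e * startVal H σ e := by
  simp only [startVal, startWt, he, if_true]
  have h0 : 0 < aliveDeg H σ e := by rw [aliveDeg_eq]; omega
  have h1 : 2 ^ (Nat.clog 2 (8 * aliveDeg H σ e)).pred < 8 * aliveDeg H σ e :=
    Nat.pow_pred_clog_lt_self one_lt_two (by omega)
  have h2 : 0 < Nat.clog 2 (8 * aliveDeg H σ e) := Nat.clog_pos one_lt_two (by omega)
  -- Rounding up to a power of two at most doubles, which turns the 8 into 16.
  have h3 : 2 ^ Nat.clog 2 (8 * aliveDeg H σ e) < 16 * aliveDeg H σ e := by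
    obtain ⟨k, hk⟩ := Nat.exists_eq_succ_of_ne_zero h2.ne'
    rw [hk] at h1 ⊢
    rw [Nat.pred_succ] at h1
    rw [pow_succ]
    omega
  have h4 : (2 : ℝ) ^ Nat.clog 2 (8 * aliveDeg H σ e) ≤ 16 * aliveDeg H σ e := by
    exact_mod_cast h3.le
  rw [one_div_pow, mul_one_div, div_le_div_iff₀ (by norm_num) (by positivity)]
  linarith

/-- If the clique has `k` alive nodes, each has at least `k - 1` alive neighbors, hence value at
most `1 / (8 * k)`. -/
theorem sum_startVal_clique (σ : ι → NodeLabel) (C : Finset ι) (hC : H.IsClique C) :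
    ∑ f ∈ C, startVal H σ f ≤ 1 / 8 := by
  classical
  set A := C.filter fun f => (σ f).alive = true with hA
  have h1 : ∑ f ∈ C, startVal H σ f = ∑ f ∈ A, startVal H σ f := by
    rw [hA, Finset.sum_filter]
    refine Finset.sum_congr rfl fun f _ => ?_
    simp only [startVal]
    split_ifs <;> rfl
  rw [h1]
  have h2 : ∀ f ∈ A, startVal H σ f ≤ 1 / (8 * A.card) := by
    intro f hf
    refine (startVal_le σ f).trans ?_
    have hpos : 0 < A.card := Finset.card_pos.2 ⟨f, hf⟩
    have hle : A.card ≤ aliveDeg H σ f := by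
      rw [aliveDeg_eq, ← Finset.card_erase_add_one hf]
      refine Nat.add_le_add_right (Finset.card_le_card fun g hg => ?_) 1
      simp only [hA, Finset.mem_erase, Finset.mem_filter] at hg hf
      simp only [Finset.mem_filter, mem_nbhd]
      exact ⟨hC hf.1 hg.2.1 hg.1.symm, hg.2.2⟩
    have hle' : (A.card : ℝ) ≤ aliveDeg H σ f := by exact_mod_cast hle
    exact one_div_le_one_div_of_le (by positivity) (by linarith)
  refine (Finset.sum_le_card_nsmul _ _ _ h2).trans ?_
  rw [nsmul_eq_mul]
  rcases Nat.eq_zero_or_pos A.card with h | h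
  · rw [h]; norm_num
  · have : (0 : ℝ) < A.card := by exact_mod_cast h
    apply le_of_eq
    field_simp

theorem sum_nbhd_startVal (hH : TwoCliqueNbhds H) (σ : ι → NodeLabel) (e : ι) :
    ∑ f ∈ nbhd H e, startVal H σ f ≤ 1 / 4 := by
  classical
  obtain ⟨C₁, C₂, h1, h2, -, hcov⟩ := hH e
  have hsub : nbhd H e ⊆ C₁ ∪ C₂ := fun f hf => Finset.mem_union.2 (hcov f (mem_nbhd.1 hf))
  calc ∑ f ∈ nbhd H e, startVal H σ f ≤ ∑ f ∈ C₁ ∪ C₂, startVal H σ f :=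
        Finset.sum_le_sum_of_subset_of_nonneg hsub fun f _ _ => startVal_nonneg σ f
    _ ≤ ∑ f ∈ C₁, startVal H σ f + ∑ f ∈ C₂, startVal H σ f := by
        rw [← Finset.sum_union_inter]
        exact le_add_of_nonneg_right (Finset.sum_nonneg fun f _ => startVal_nonneg σ f)
    _ ≤ 1 / 4 := by linarith [sum_startVal_clique σ C₁ h1, sum_startVal_clique σ C₂ h2]

/-- Every alive node contributes at least 1/16 to the gain, and the cost is at most a quarter of the
gain. With `c ≤ 3` a quarter of the gain survives. -/
theorem start_gain_sub_cost (hH : TwoCliqueNbhds H) (σ : ι → NodeLabel) {c : ℝ}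
    (hc : c ≤ 3) :
    ((aliveSet σ).card : ℝ) / 64 ≤
      gain (startWt H σ) (startVal H σ) - c * cost H (startWt H σ) (startVal H σ) := by
  have h1 : cost H (startWt H σ) (startVal H σ) ≤ 1 / 4 * gain (startWt H σ) (startVal H σ) := by
    unfold cost gain
    rw [Finset.mul_sum]
    refine Finset.sum_le_sum fun e _ => ?_
    rw [← Finset.mul_sum, mul_comm (1 / 4 : ℝ)]
    exact mul_le_mul_of_nonneg_left (sum_nbhd_startVal hH σ e)
      (mul_nonneg (startWt_nonneg σ e) (startVal_nonneg σ e))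
  have h2 : ((aliveSet σ).card : ℝ) / 16 ≤ gain (startWt H σ) (startVal H σ) := by
    unfold gain
    calc ((aliveSet σ).card : ℝ) / 16 = ∑ e ∈ aliveSet σ, (1 / 16 : ℝ) := by
          rw [Finset.sum_const, nsmul_eq_mul]; ring
      _ ≤ ∑ e ∈ aliveSet σ, startWt H σ e * startVal H σ e :=
          Finset.sum_le_sum fun e he => le_startWt_mul_startVal σ e (mem_aliveSet.1 he)
      _ ≤ _ := Finset.sum_le_sum_of_subset_of_nonneg (Finset.subset_univ _) fun e _ _ =>
          mul_nonneg (startWt_nonneg σ e) (startVal_nonneg σ e)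
  have h3 : 0 ≤ cost H (startWt H σ) (startVal H σ) :=
    cost_nonneg (startWt_nonneg σ) (startVal_nonneg σ)
  nlinarith

/-- The nodes of value one without neighbors of value one. -/
def Chosen (H : SimpleGraph ι) (y : ι → ℝ) (e : ι) : Prop := y e = 1 ∧ ∀ f, H.Adj e f → y f ≠ 1

-- A node contributes `w e * y e * (1 - ∑ y f)`, summed over its neighbors `f`. This is `w e` for a
-- chosen node and at most 0 for any other.
open Classical in
theorem gain_sub_cost_le_chosen (w y : ι → ℝ) (hw : ∀ e, 0 ≤ w e) (hy : ∀ e, y e = 0 ∨ y e = 1) :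
    gain w y - cost H w y ≤ ∑ e ∈ Finset.univ.filter (Chosen H y), w e := by
  unfold gain cost
  rw [← Finset.sum_sub_distrib, Finset.sum_filter]
  refine Finset.sum_le_sum fun e _ => ?_
  have hy0 : ∀ f, 0 ≤ y f := fun f => by rcases hy f with h | h <;> rw [h]; norm_num
  rw [← Finset.mul_sum]
  have hs : 0 ≤ ∑ f ∈ nbhd H e, y f := Finset.sum_nonneg fun f _ => hy0 f
  split_ifs with hch
  · rw [hch.1]
    nlinarith [mul_nonneg (hw e) hs]
  · rcases hy e with h | h
    · simp [h]
    · have : ∃ f, H.Adj e f ∧ y f = 1 := by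
        by_contra! hcon
        exact hch ⟨h, hcon⟩
      obtain ⟨f, hf, hf1⟩ := this
      have h1 : y f ≤ ∑ f ∈ nbhd H e, y f :=
        Finset.single_le_sum (fun g _ => hy0 g) (mem_nbhd.2 hf)
      rw [hf1] at h1
      rw [h]
      nlinarith [mul_le_mul_of_nonneg_left h1 (hw e)]

open Classical in
/-- Independent nodes of large total degree dominate many nodes. -/
theorem sum_aliveDeg_le (hH : TwoCliqueNbhds H) (σ : ι → NodeLabel) (M : Finset ι)
    (hM : ∀ e ∈ M, (σ e).alive = true) (hind : ∀ e ∈ M, ∀ f ∈ M, ¬ H.Adj e f) :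
    ∑ e ∈ M, aliveDeg H σ e ≤
      2 * ((aliveSet σ).filter fun f => f ∈ M ∨ ∃ e ∈ M, H.Adj f e).card := by
  set R := (aliveSet σ).filter fun f => f ∈ M ∨ ∃ e ∈ M, H.Adj f e with hR
  have h1 : ∀ e ∈ M, aliveDeg H σ e = ∑ f ∈ R, if f = e ∨ H.Adj f e then 1 else 0 := by
    intro e he
    rw [← Finset.card_filter, aliveDeg_eq]
    have : R.filter (fun f => f = e ∨ H.Adj f e) =
        insert e ((nbhd H e).filter fun f => (σ f).alive = true) := by
      ext f
      simp only [hR, Finset.mem_filter, mem_aliveSet, Finset.mem_insert, mem_nbhd, H.adj_comm e f]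
      constructor
      · rintro ⟨⟨h2, -⟩, rfl | h3⟩
        · exact Or.inl rfl
        · exact Or.inr ⟨h3, h2⟩
      · rintro (rfl | ⟨h2, h3⟩)
        · exact ⟨⟨hM _ he, Or.inl he⟩, Or.inl rfl⟩
        · exact ⟨⟨h3, Or.inr ⟨e, he, h2⟩⟩, Or.inr h2⟩
    rw [this, Finset.card_insert_of_notMem]
    simp
  rw [Finset.sum_congr rfl h1, Finset.sum_comm, mul_comm, ← smul_eq_mul]
  refine Finset.sum_le_card_nsmul _ _ _ fun f _ => ?_
  rw [← Finset.card_filter]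
  obtain ⟨C₁, C₂, hC₁, hC₂, hf, hcov⟩ := hH f
  -- An independent set meets each of the two cliques at most once, so `f` is counted at most twice.
  have hclique : ∀ C : Finset ι, H.IsClique C → (M ∩ C).card ≤ 1 := by
    intro C hC
    refine Finset.card_le_one.2 fun a ha b hb => ?_
    rw [Finset.mem_inter] at ha hb
    by_contra hab
    exact hind a ha.1 b hb.1 (hC ha.2 hb.2 hab)
  have hsub : M.filter (fun e => f = e ∨ H.Adj f e) ⊆ (M ∩ C₁) ∪ (M ∩ C₂) := by
    intro e he
    rw [Finset.mem_filter] at he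
    rw [Finset.mem_union, Finset.mem_inter, Finset.mem_inter]
    rcases he.2 with rfl | h
    · exact Or.inl ⟨he.1, hf⟩
    · exact (hcov e h).imp (fun h => ⟨he.1, h⟩) fun h => ⟨he.1, h⟩
  have := (Finset.card_le_card hsub).trans (Finset.card_union_le _ _)
  have := hclique C₁ hC₁
  have := hclique C₂ hC₂
  omega

/-- The rules of one phase, which removes a constant fraction of the nodes. -/
noncomputable def phaseRules (p₁ D₁ : ℕ) (h₁ : ℕ → ℕ → ℕ) (p₂ D₂ : ℕ) (h₂ : ℕ → ℕ → ℕ) (η : ℝ)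
    (l : ℕ) : List (LabelRule NodeLabel) :=
  startRule :: (roundingRules p₁ D₁ h₁ p₂ D₂ h₂ η l ++ [selectRule, leaveRule])

/-- The potential bound gives the chosen nodes a total alive degree, each counted with itself, of at
least 1/64 of the alive count. At least half as many nodes are dominated by them and leave. -/
theorem phaseRules_spec {p₁ D₁ : ℕ} {h₁ : ℕ → ℕ → ℕ} {p₂ D₂ : ℕ} {h₂ : ℕ → ℕ → ℕ} {η : ℝ}
    (hp₁ : 0 < p₁) (hp₂ : 0 < p₂) (hh₁ : IsColorCode p₁ D₁ h₁) (hh₂ : IsColorCode p₂ D₂ h₂)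
    (hpp : p₁ * p₁ ≤ p₂ ^ D₂) (hη : (D₁ / p₁ + 4 * D₂ / p₂ : ℝ) ≤ η) {l : ℕ}
    (hl : (1 + η) ^ l ≤ 3) (hH : TwoCliqueNbhds H)
    (hdeg : ∀ e, 8 * ((nbhd H e).card + 1) ≤ 2 ^ l) (σ : ι → NodeLabel)
    (hσ : ProperBase H (p₁ ^ D₁) σ) (hinv : SelectionInv H σ) :
    ∃ σ', runRules H (phaseRules p₁ D₁ h₁ p₂ D₂ h₂ η l) σ = σ' ∧
      (∀ e, (σ' e).base = (σ e).base) ∧ SelectionInv H σ' ∧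
      ((aliveSet σ').card : ℝ) ≤ 127 / 128 * (aliveSet σ).card := by
  classical
  have hstart : applyRule H startRule σ =
      fun e => { σ e with wt := startWt H σ e, val := startVal H σ e } := rfl
  obtain ⟨y, hy, hy0, hgain, lev, slot, hrun⟩ := roundingRules_spec (H := H) hp₁ hp₂ hh₁ hh₂ hpp hη l
    (fun e => { σ e with wt := startWt H σ e, val := startVal H σ e })
    (hσ.congr fun _ => rfl) (startWt_nonneg σ) (by
      intro e
      change startVal H σ e = 0 ∨ ∃ k ≤ l, startVal H σ e = _
      unfold startVal
      split_ifs
      · refine Or.inr ⟨_, ?_, rfl⟩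
        apply Nat.clog_le_of_le_pow
        refine le_trans ?_ (hdeg e)
        rw [aliveDeg_eq]
        have := Finset.card_filter_le (nbhd H e) fun f => (σ f).alive = true
        omega
      · exact Or.inl rfl)
  have hyalive : ∀ e, y e = 1 → (σ e).alive = true := by
    intro e he
    by_contra hna
    have : y e = 0 := hy0 e (by simp [startVal, hna])
    rw [this] at he
    norm_num at he
  set sel' : ι → Bool := fun e => (σ e).sel || decide (Chosen H y e) with hsel'
  have hselect : applyRule H selectRule
      (fun e => { σ e with
        wt := startWt H σ e, lev := lev e, slot := slot e, val := y e }) =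
      fun e => { σ e with
        wt := startWt H σ e, lev := lev e, slot := slot e, val := y e, sel := sel' e } := by
    funext e
    simp only [applyRule, selectRule, sel']
    congr 2
    apply decide_eq_decide.2
    simp [Chosen]
  have hfinal : runRules H [selectRule, leaveRule] (fun e => { σ e with
        wt := startWt H σ e, lev := lev e, slot := slot e, val := y e }) =
      fun e => { σ e with
        wt := startWt H σ e, lev := lev e, slot := slot e, val := y e, sel := sel' e,
        alive := decide (sel' e = false ∧ ∀ f, H.Adj e f → sel' f = false) } := by
    rw [runRules, hselect]
    funext e
    simp [runRules, applyRule, leaveRule]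
  have hsel : ∀ e, sel' e = true ↔ (σ e).sel = true ∨ Chosen H y e := fun e => by simp [sel']
  -- Newly chosen nodes were alive, so they have no neighbor selected earlier.
  have hmix : ∀ e f, (σ e).sel = true → Chosen H y f → ¬ H.Adj f e := by
    intro e f he hf hadj
    have := ((hinv.alive_iff f).1 (hyalive f hf.1)).2 e hadj
    rw [he] at this
    cases this
  refine ⟨fun e => { σ e with
        wt := startWt H σ e, lev := lev e, slot := slot e, val := y e, sel := sel' e,
        alive := decide (sel' e = false ∧ ∀ f, H.Adj e f → sel' f = false) },
    by rw [phaseRules, runRules, hstart, runRules_append, hrun]; exact hfinal,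
    fun _ => rfl, ⟨?_, fun e => decide_eq_true_iff⟩, ?_⟩
  · intro e f he hf hadj
    rcases (hsel e).1 he with h1 | h1 <;> rcases (hsel f).1 hf with h2 | h2
    · exact hinv.indep e f h1 h2 hadj
    · exact hmix e f h1 h2 hadj.symm
    · exact hmix f e h2 h1 hadj
    · exact h1.2 f hadj h2.1
  · set M := Finset.univ.filter (Chosen H y) with hM
    set R := (aliveSet σ).filter fun f => f ∈ M ∨ ∃ e ∈ M, H.Adj f e with hR
    have hMalive : ∀ e ∈ M, (σ e).alive = true := fun e he =>
      hyalive e (Finset.mem_filter.1 he).2.1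
    have h1 : ((aliveSet σ).card : ℝ) / 64 ≤ ∑ e ∈ M, startWt H σ e :=
      (start_gain_sub_cost hH σ hl).trans
        (hgain.trans (gain_sub_cost_le_chosen _ y (startWt_nonneg σ) hy))
    have h2 : ∑ e ∈ M, startWt H σ e = ((∑ e ∈ M, aliveDeg H σ e : ℕ) : ℝ) := by
      rw [Nat.cast_sum]
      exact Finset.sum_congr rfl fun e he => if_pos (hMalive e he)
    have h3 : ((∑ e ∈ M, aliveDeg H σ e : ℕ) : ℝ) ≤ 2 * (R.card : ℝ) := by
      exact_mod_cast sum_aliveDeg_le hH σ M hMalive fun e he f hf hadj =>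
        (Finset.mem_filter.1 he).2.2 f hadj (Finset.mem_filter.1 hf).2.1
    have h4 : R.card ≤ (aliveSet σ).card := Finset.card_filter_le _ _
    -- The survivors avoid `R`, the alive nodes that are chosen or adjacent to a chosen node.
    refine le_trans (Nat.cast_le.2 (Finset.card_le_card (t := aliveSet σ \ R) ?_)) ?_
    · intro e he
      rw [mem_aliveSet] at he
      have he' := of_decide_eq_true he
      have hns : ∀ f, sel' f = false → (σ f).sel = false ∧ ¬ Chosen H y f := by
        intro f hf
        simpa [sel'] using hf
      rw [Finset.mem_sdiff, mem_aliveSet, hinv.alive_iff]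
      refine ⟨⟨(hns e he'.1).1, fun f hf => (hns f (he'.2 f hf)).1⟩, fun heR => ?_⟩
      rcases (Finset.mem_filter.1 heR).2 with h | ⟨f, hf, hadj⟩
      · exact (hns e he'.1).2 (Finset.mem_filter.1 h).2
      · exact (hns f (he'.2 f hadj)).2 (Finset.mem_filter.1 hf).2
    · rw [Finset.card_sdiff_of_subset (Finset.filter_subset _ _), Nat.cast_sub h4]
      linarith

end Phase

-- Choice of parameters and the complete rule list

universe u

/-- With unit weights, the number of conflicts at the best place is at most `4 * deg / p < 1`, hence
zero: the new coloring is proper. The rule is chosen before the graph, so that it can depend only on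
globally known parameters. -/
theorem exists_properRule (d b : ℕ) (hb : 4 * d + 12 ≤ b) :
    ∃ r : LabelRule NodeLabel, ∀ (ι : Type u) [Fintype ι] (H : SimpleGraph ι),
      (∀ e, (nbhd H e).card < 2 ^ (d + 1)) → ∀ σ, ProperBase H (2 ^ (b + 1)) σ →
      ProperBase H (2 ^ b) (applyRule H r σ) ∧
      ∀ e, (applyRule H r σ e).alive = (σ e).alive ∧ (applyRule H r σ e).sel = (σ e).sel := by
  -- With `p` between `2 ^ j` and `2 ^ (j + 1)`, `p ^ 4` covers the old colors while `p ^ 2` stays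
  -- within `2 ^ b`.
  set j := b / 4 + 1 with hj
  obtain ⟨p, hp, hjp, hpj⟩ := Nat.exists_prime_lt_and_le_two_mul (2 ^ j) (by positivity)
  obtain ⟨h, hh⟩ := exists_isColorCode (D := 4) hp (by norm_num)
  have hm : 2 ^ (b + 1) ≤ p ^ 4 :=
    calc 2 ^ (b + 1) ≤ 2 ^ (j * 4) := Nat.pow_le_pow_right (by norm_num) (by omega)
      _ = (2 ^ j) ^ 4 := pow_mul _ _ _
      _ ≤ p ^ 4 := Nat.pow_le_pow_left hjp.le 4
  have hpp : p * p ≤ 2 ^ b :=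
    calc p * p ≤ (2 * 2 ^ j) * (2 * 2 ^ j) := Nat.mul_le_mul hpj hpj
      _ = 2 ^ (2 * j + 2) := by ring
      _ ≤ 2 ^ b := Nat.pow_le_pow_right (by norm_num) (by omega)
  refine ⟨NodeLabel.properRule p 4 h, fun ι _ H hdeg σ hσ => ⟨⟨fun e => ?_, fun e f hef => ?_⟩,
    fun e => ⟨rfl, rfl⟩⟩⟩
  · exact lt_of_lt_of_le (newColor_lt hp.pos hh (fun _ _ => 1) σ (fun _ _ => zero_le_one)
      (fun e => lt_of_lt_of_le (hσ.lt e) hm) e) hpp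
  · intro heq
    have h1 := newColor_mono (H := H) hp.pos hh (fun _ _ => 1) σ (fun _ _ => zero_le_one)
      ⟨fun e => lt_of_lt_of_le (hσ.lt e) hm, hσ.ne⟩ e
    have h2 := Finset.single_le_sum (f := fun f =>
      if NodeLabel.newColor p 4 h (fun _ _ => 1) (σ e) ((nbhd H e).val.map σ) =
        NodeLabel.newColor p 4 h (fun _ _ => 1) (σ f) ((nbhd H f).val.map σ) then (1 : ℝ) else 0)
      (fun g _ => by positivity) (mem_nbhd.2 hef)
    have h3 : (if NodeLabel.newColor p 4 h (fun _ _ => 1) (σ e) ((nbhd H e).val.map σ) =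
        NodeLabel.newColor p 4 h (fun _ _ => 1) (σ f) ((nbhd H f).val.map σ)
        then (1 : ℝ) else 0) = 1 := if_pos heq
    simp only [h3] at h2
    have h4 : 4 * (nbhd H e).card < p := by
      have h5 : 2 ^ (d + 3) ≤ 2 ^ j := Nat.pow_le_pow_right (by norm_num) (by omega)
      have h6 := hdeg e
      rw [pow_succ] at h6
      rw [pow_add] at h5
      omega
    have h5 : (4 * (nbhd H e).card : ℝ) < p := by exact_mod_cast h4
    rw [Finset.sum_const, nsmul_eq_mul, mul_one] at h1
    have h6 := mul_le_mul_of_nonneg_left h2 (Nat.cast_nonneg (α := ℝ) p)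
    push_cast at h1
    linarith

/-- Saving one bit per round is slow, but `k` will be O(log n), which the total running time
affords. -/
theorem exists_properRules (d k : ℕ) :
    ∃ P : List (LabelRule NodeLabel), P.length = k ∧
      ∀ (ι : Type u) [Fintype ι] (H : SimpleGraph ι),
      (∀ e, (nbhd H e).card < 2 ^ (d + 1)) → ∀ σ, ProperBase H (2 ^ (4 * d + 12 + k)) σ →
      ProperBase H (2 ^ (4 * d + 12)) (runRules H P σ) ∧
      ∀ e, (runRules H P σ e).alive = (σ e).alive ∧ (runRules H P σ e).sel = (σ e).sel := by
  induction k with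
  | zero => exact ⟨[], rfl, fun ι _ H _ σ hσ => ⟨hσ, fun e => ⟨rfl, rfl⟩⟩⟩
  | succ k ih =>
    obtain ⟨P, hlen, hP⟩ := ih
    obtain ⟨r, hr⟩ := exists_properRule.{u} d (4 * d + 12 + k) (by omega)
    refine ⟨r :: P, by simp [hlen], fun ι _ H hdeg σ hσ => ?_⟩
    obtain ⟨h1, h2⟩ := hr ι H hdeg σ hσ
    obtain ⟨h3, h4⟩ := hP ι H hdeg _ h1
    exact ⟨h3, fun e => ⟨(h4 e).1.trans (h2 e).1, (h4 e).2.trans (h2 e).2⟩⟩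

theorem exists_phaseRules (d : ℕ) :
    ∃ P : List (LabelRule NodeLabel), P.length ≤ 132 * (d + 4) ^ 2 ∧
      ∀ (ι : Type u) [Fintype ι] (H : SimpleGraph ι), TwoCliqueNbhds H →
      (∀ e, (nbhd H e).card < 2 ^ (d + 1)) → ∀ σ, ProperBase H (2 ^ (4 * d + 12)) σ →
      SelectionInv H σ → ProperBase H (2 ^ (4 * d + 12)) (runRules H P σ) ∧
      SelectionInv H (runRules H P σ) ∧
      ((aliveSet (runRules H P σ)).card : ℝ) ≤ 127 / 128 * (aliveSet σ).card := by
  -- Alive degrees plus one are at most `2 ^ (d + 1)`, so starting values are at least `(1 / 2) ^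
  -- l`. The primes of order `l ^ 2` and `l` make each of the two sources of loss at most `1 / (2 *
  -- l)`.
  set l := d + 4 with hl
  have hl0 : 0 < l := by omega
  obtain ⟨p₁, hp₁, hlp₁, hpl₁⟩ := Nat.exists_prime_lt_and_le_two_mul (8 * l ^ 2) (by positivity)
  obtain ⟨p₂, hp₂, hlp₂, hpl₂⟩ := Nat.exists_prime_lt_and_le_two_mul (32 * l) (by positivity)
  obtain ⟨h₁, hh₁⟩ := exists_isColorCode (D := 4 * d + 12) hp₁ (by omega)
  obtain ⟨h₂, hh₂⟩ := exists_isColorCode (D := 4) hp₂ (by omega)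
  have hlR : (0 : ℝ) < l := by exact_mod_cast hl0
  have hpp : p₁ * p₁ ≤ p₂ ^ 4 :=
    calc p₁ * p₁ ≤ (2 * (8 * l ^ 2)) * (2 * (8 * l ^ 2)) := Nat.mul_le_mul hpl₁ hpl₁
      _ = 256 * l ^ 4 := by ring
      _ ≤ (32 * l) ^ 4 := by
        rw [mul_pow]; exact Nat.mul_le_mul_right _ (by norm_num)
      _ ≤ p₂ ^ 4 := Nat.pow_le_pow_left hlp₂.le 4
  have hη : ((4 * d + 12 : ℕ) / p₁ + 4 * (4 : ℕ) / p₂ : ℝ) ≤ 1 / l := by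
    have e1 : ((4 * d + 12 : ℕ) / p₁ : ℝ) ≤ 1 / (2 * l) := by
      rw [div_le_div_iff₀ (by exact_mod_cast hp₁.pos) (by positivity)]
      have : (4 * d + 12) * (2 * l) ≤ 1 * p₁ := by
        refine le_trans ?_ (by omega : 8 * l ^ 2 ≤ 1 * p₁)
        have : 4 * d + 12 ≤ 4 * l := by omega
        nlinarith
      exact_mod_cast this
    have e2 : (4 * (4 : ℕ) / p₂ : ℝ) ≤ 1 / (2 * l) := by
      rw [div_le_div_iff₀ (by exact_mod_cast hp₂.pos) (by positivity)]
      have : 4 * 4 * (2 * l) ≤ 1 * p₂ := by omega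
      exact_mod_cast this
    have e3 : (1 / (2 * l) + 1 / (2 * l) : ℝ) = 1 / l := by field_simp; norm_num
    linarith
  have hexp : (1 + 1 / l : ℝ) ^ l ≤ 3 := by
    have h1 : (1 + 1 / l : ℝ) ≤ Real.exp (1 / l) := by
      rw [add_comm]; exact Real.add_one_le_exp _
    calc (1 + 1 / l : ℝ) ^ l ≤ Real.exp (1 / l) ^ l := pow_le_pow_left₀ (by positivity) h1 l
      _ = Real.exp 1 := by
        rw [← Real.exp_nat_mul]; congr 1; field_simp
      _ ≤ 3 := by linarith [Real.exp_one_lt_d9]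
  refine ⟨phaseRules p₁ (4 * d + 12) h₁ p₂ 4 h₂ (1 / l) l, ?_, fun ι _ H hH hdeg σ hσ hinv => ?_⟩
  · simp only [phaseRules, List.length_cons, List.length_append, length_roundingRules,
      List.length_nil]
    have : 2 * p₂ + 1 ≤ 129 * l := by omega
    have := Nat.mul_le_mul_left l this
    have h1 : l * (129 * l) = 129 * l ^ 2 := by ring
    have h2 : 1 ≤ l ^ 2 := Nat.one_le_pow _ _ hl0
    omega
  · have hle : 2 ^ (4 * d + 12) ≤ p₁ ^ (4 * d + 12) := Nat.pow_le_pow_left hp₁.two_le _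
    obtain ⟨σ', hrun, hbase, hinv', hcard⟩ := phaseRules_spec hp₁.pos hp₂.pos hh₁ hh₂ hpp hη hexp hH
      (fun e => by
        have h1 := hdeg e
        have h2 : 2 ^ l = 8 * 2 ^ (d + 1) := by rw [hl]; ring
        omega)
      σ ⟨fun e => lt_of_lt_of_le (hσ.lt e) hle, hσ.ne⟩ hinv
    rw [hrun]
    exact ⟨hσ.congr hbase, hinv', hcard⟩

theorem exists_iteratedPhaseRules (d k : ℕ) :
    ∃ P : List (LabelRule NodeLabel), P.length ≤ k * (132 * (d + 4) ^ 2) ∧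
      ∀ (ι : Type u) [Fintype ι] (H : SimpleGraph ι), TwoCliqueNbhds H →
      (∀ e, (nbhd H e).card < 2 ^ (d + 1)) → ∀ σ, ProperBase H (2 ^ (4 * d + 12)) σ →
      SelectionInv H σ → SelectionInv H (runRules H P σ) ∧
      ((aliveSet (runRules H P σ)).card : ℝ) ≤ (127 / 128) ^ k * (aliveSet σ).card := by
  induction k with
  | zero => exact ⟨[], by simp, fun ι _ H _ _ σ _ hinv => ⟨hinv, by simp [runRules]⟩⟩
  | succ k ih =>
    obtain ⟨P, hlen, hP⟩ := ih
    obtain ⟨Q, hlenQ, hQ⟩ := exists_phaseRules.{u} d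
    refine ⟨Q ++ P, by rw [List.length_append]; linarith, fun ι _ H hH hdeg σ hσ hinv => ?_⟩
    obtain ⟨h1, h2, h3⟩ := hQ ι H hH hdeg σ hσ hinv
    obtain ⟨h4, h5⟩ := hP ι H hH hdeg _ h1 h2
    rw [runRules_append]
    refine ⟨h4, h5.trans ?_⟩
    rw [pow_succ, mul_assoc]
    exact mul_le_mul_of_nonneg_left h3 (by positivity)

/-- The label of a node before the first round. -/
def NodeLabel.fresh (c : ℕ) : NodeLabel := ⟨c, 0, none, 0, 0, true, false⟩

/-- A maximal independent set of a graph whose neighborhoods consist of two cliques can be computed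
from an injective coloring by few local rules. -/
theorem exists_independentSetRules (d b : ℕ) :
    ∃ P : List (LabelRule NodeLabel),
      P.length ≤ 2 * b + 89 * (2 * b + 1) * (132 * (d + 4) ^ 2) ∧
      ∀ (ι : Type u) [Fintype ι] (H : SimpleGraph ι), TwoCliqueNbhds H →
      (∀ e, (nbhd H e).card < 2 ^ (d + 1)) →
      ∀ c : ι → ℕ, Function.Injective c → (∀ e, c e < 2 ^ (2 * b)) →
      (∀ e f, (runRules H P (fun e => .fresh (c e)) e).sel = true →
        (runRules H P (fun e => .fresh (c e)) f).sel = true → ¬ H.Adj e f) ∧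
      ∀ e, (runRules H P (fun e => .fresh (c e)) e).sel = false →
        ∃ f, H.Adj e f ∧ (runRules H P (fun e => .fresh (c e)) f).sel = true := by
  obtain ⟨P, hlenP, hP⟩ := exists_properRules.{u} d (2 * b)
  obtain ⟨Q, hlenQ, hQ⟩ := exists_iteratedPhaseRules.{u} d (89 * (2 * b + 1))
  refine ⟨P ++ Q, by rw [List.length_append]; omega, fun ι _ H hH hdeg c hinj hc => ?_⟩
  set σ : ι → NodeLabel := fun e => .fresh (c e) with hσ
  have h0 : ProperBase H (2 ^ (4 * d + 12 + 2 * b)) σ :=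
    ⟨fun e => lt_of_lt_of_le (hc e) (Nat.pow_le_pow_right (by norm_num) (by omega)),
      fun e f hef heq => hef.ne (hinj heq)⟩
  obtain ⟨h1, h2⟩ := hP ι H hdeg σ h0
  have hinv : SelectionInv H (runRules H P σ) := by
    refine ⟨fun e f he => ?_, fun e => ?_⟩
    · rw [(h2 e).2] at he
      cases he
    · rw [(h2 e).1, (h2 e).2]
      exact ⟨fun _ => ⟨rfl, fun f _ => (h2 f).2⟩, fun _ => rfl⟩
  obtain ⟨h3, h4⟩ := hQ ι H hH hdeg _ h1 hinv
  rw [runRules_append]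
  refine ⟨h3.indep, fun e he => ?_⟩
  have hcard : (aliveSet (runRules H P σ)).card ≤ 2 ^ (2 * b) := by
    refine (Finset.card_le_univ _).trans ?_
    have := Fintype.card_le_of_injective (fun e => (⟨c e, hc e⟩ : Fin (2 ^ (2 * b))))
      fun e f hef => hinj (congrArg Fin.val hef)
    simpa using this
  have hlt : ((aliveSet (runRules H Q (runRules H P σ))).card : ℝ) < 1 := by
    refine lt_of_le_of_lt h4 ?_
    -- 89 phases halve the number of alive nodes; initially there are at most `2 ^ (2 * b)`, the
    -- number of available colors.
    have e1 : ((127 : ℝ) / 128) ^ (89 * (2 * b + 1)) ≤ (1 / 2) ^ (2 * b + 1) := by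
      rw [pow_mul]
      exact pow_le_pow_left₀ (by positivity) (by norm_num) _
    have e2 : ((aliveSet (runRules H P σ)).card : ℝ) ≤ 2 ^ (2 * b) := by exact_mod_cast hcard
    calc ((127 : ℝ) / 128) ^ (89 * (2 * b + 1)) * (aliveSet (runRules H P σ)).card
        ≤ (1 / 2) ^ (2 * b + 1) * 2 ^ (2 * b) := mul_le_mul e1 e2 (by positivity) (by positivity)
      _ = 1 / 2 := by
        rw [pow_succ, one_div_pow]
        field_simp
      _ < 1 := by norm_num
  have hempty : aliveSet (runRules H Q (runRules H P σ)) = ∅ := by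
    rw [← Finset.card_eq_zero]
    have : (aliveSet (runRules H Q (runRules H P σ))).card < 1 := by exact_mod_cast hlt
    omega
  by_contra! hcon
  have : e ∈ aliveSet (runRules H Q (runRules H P σ)) :=
    mem_aliveSet.2 ((h3.alive_iff e).2 ⟨he, fun f hf => by simpa using hcon f hf⟩)
  rw [hempty] at this
  simp at this

/-! ### Line graphs, matchings and edge colors -/

section LineGraph

variable {V : Type*} {G : SimpleGraph V}

open Classical in
/-- The edges at a node. -/
noncomputable def edgesAt (G : SimpleGraph V) [Fintype G.edgeSet] (v : V) : Finset G.edgeSet :=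
  Finset.univ.filter fun e => v ∈ e.1

theorem mem_edgesAt [Fintype G.edgeSet] {v : V} {e : G.edgeSet} : e ∈ edgesAt G v ↔ v ∈ e.1 := by
  simp [edgesAt]

theorem isClique_edgesAt [Fintype G.edgeSet] (v : V) :
    G.lineGraph.IsClique (edgesAt G v : Set G.edgeSet) := by
  intro e he f hf hne
  rw [Finset.mem_coe, mem_edgesAt] at he hf
  exact SimpleGraph.lineGraph_adj_iff_exists.2 ⟨hne, v, he, hf⟩

theorem twoCliqueNbhds_lineGraph [Fintype G.edgeSet] : TwoCliqueNbhds G.lineGraph := by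
  rintro ⟨e, he⟩
  induction e with
  | _ u v =>
    refine ⟨edgesAt G u, edgesAt G v, isClique_edgesAt u, isClique_edgesAt v,
      mem_edgesAt.2 (Sym2.mem_mk_left _ _), fun f hf => ?_⟩
    obtain ⟨-, w, hw, hwf⟩ := SimpleGraph.lineGraph_adj_iff_exists.1 hf
    rw [mem_edgesAt, mem_edgesAt]
    rcases Sym2.mem_iff.1 hw with rfl | rfl
    · exact Or.inl hwf
    · exact Or.inr hwf

variable [Fintype V] [DecidableRel G.Adj]

theorem Network.card_edgesAt_le [Fintype G.edgeSet] (net : Network G) (v : V) :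
    (edgesAt G v).card ≤ G.degree v := by
  classical
  have hsub : edgesAt G v ⊆ Finset.univ.image (net.edge v) := by
    intro e he
    obtain ⟨p, hp⟩ := net.exists_edge_eq v e (mem_edgesAt.1 he)
    exact Finset.mem_image.2 ⟨p, Finset.mem_univ _, hp⟩
  simpa using (Finset.card_le_card hsub).trans Finset.card_image_le

theorem Network.card_nbhd_lineGraph_lt [Fintype G.edgeSet] (net : Network G) (e : G.edgeSet) :
    (nbhd G.lineGraph e).card < 2 * G.maxDegree := by
  classical
  obtain ⟨e, he⟩ := e
  induction e with
  | _ u v =>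
    have hsub : insert ⟨s(u, v), he⟩ (nbhd G.lineGraph ⟨s(u, v), he⟩) ⊆
        edgesAt G u ∪ edgesAt G v := by
      intro f hf
      rw [Finset.mem_union, mem_edgesAt, mem_edgesAt]
      rcases Finset.mem_insert.1 hf with rfl | hf
      · exact Or.inl (Sym2.mem_mk_left _ _)
      · obtain ⟨-, w, hw, hwf⟩ := SimpleGraph.lineGraph_adj_iff_exists.1 (mem_nbhd.1 hf)
        rcases Sym2.mem_iff.1 hw with rfl | rfl
        · exact Or.inl hwf
        · exact Or.inr hwf
    have h1 := (Finset.card_le_card hsub).trans (Finset.card_union_le _ _)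
    rw [Finset.card_insert_of_notMem (by simp)] at h1
    have h2 := (net.card_edgesAt_le u).trans (G.degree_le_maxDegree u)
    have h3 := (net.card_edgesAt_le v).trans (G.degree_le_maxDegree v)
    omega

end LineGraph

/-- A maximal independent set of the line graph is a maximal matching. -/
theorem isMaximalEdgeMatching_of_lineGraph {V : Type*} {G : SimpleGraph V}
    (S : G.edgeSet → Prop)
    (hind : ∀ e f, S e → S f → ¬ G.lineGraph.Adj e f)
    (hmax : ∀ e, ¬ S e → ∃ f, G.lineGraph.Adj e f ∧ S f) :
    IsMaximalEdgeMatching G {e | ∃ h : e ∈ G.edgeSet, S ⟨e, h⟩} := by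
  refine ⟨⟨fun e he => he.1, ?_⟩, fun e he heS hM => ?_⟩
  · rintro e ⟨he, hSe⟩ f ⟨hf, hSf⟩ hne v ⟨hve, hvf⟩
    exact hind _ _ hSe hSf (SimpleGraph.lineGraph_adj_iff_exists.2
      ⟨fun h => hne (congrArg Subtype.val h), v, hve, hvf⟩)
  · obtain ⟨f, hadj, hSf⟩ := hmax ⟨e, he⟩ fun h => heS ⟨he, h⟩
    obtain ⟨hne, v, hve, hvf⟩ := SimpleGraph.lineGraph_adj_iff_exists.1 hadj
    exact hM.2 e (Set.mem_insert _ _) f.1 (Set.mem_insert_of_mem _ ⟨f.2, hSf⟩)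
      (fun h => hne (Subtype.ext h)) v ⟨hve, hvf⟩

/-- The color of an edge given by the identifiers of its endpoints. -/
def pairColor (b : ℕ) (e : Sym2 ℕ) : ℕ := e.inf * 2 ^ b + e.sup

theorem inf_sup_lt {m : ℕ} (e : Sym2 ℕ) (he : ∀ x ∈ e, x < m) : e.inf < m ∧ e.sup < m := by
  induction e with
  | _ x y =>
    have hx := he x (Sym2.mem_mk_left _ _)
    have hy := he y (Sym2.mem_mk_right _ _)
    simp only [Sym2.inf_mk, Sym2.sup_mk]
    exact ⟨lt_of_le_of_lt inf_le_left hx, sup_lt_iff.2 ⟨hx, hy⟩⟩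

theorem pairColor_lt {b : ℕ} (e : Sym2 ℕ) (he : ∀ x ∈ e, x < 2 ^ b) :
    pairColor b e < 2 ^ (2 * b) := by
  obtain ⟨h1, h2⟩ := inf_sup_lt e he
  rw [two_mul, pow_add]
  unfold pairColor
  nlinarith

theorem pairColor_injOn {b : ℕ} (e f : Sym2 ℕ) (he : ∀ x ∈ e, x < 2 ^ b)
    (hf : ∀ x ∈ f, x < 2 ^ b) (h : pairColor b e = pairColor b f) : e = f := by
  have h1 := (inf_sup_lt e he).2
  have h2 := (inf_sup_lt f hf).2
  have hpos : 0 < 2 ^ b := by positivity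
  unfold pairColor at h
  have h3 : e.inf = f.inf := by
    have := congrArg (· / 2 ^ b) h
    simpa [mul_comm _ (2 ^ b), Nat.mul_add_div hpos, Nat.div_eq_of_lt, h1, h2] using this
  have h4 : e.sup = f.sup := by
    rw [h3] at h
    omega
  exact Sym2.inf_eq_inf_and_sup_eq_sup.1 ⟨h3, h4⟩

/-- From `1 ≤ L ≤ K * δ` follows `K * L + 4 ≤ 5 * K * L ≤ 5 * K ^ 2 * δ`, and `n ≥ 2` absorbs the
rounding up in `clog`: it is at most `2 * a * logb 2 n`. The numerical constant is generous. -/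
theorem round_bound {a K L n N : ℕ} {δ : ℝ} (hL : L ≠ 0) (hLK : (L : ℝ) ≤ K * δ)
    (hN : N ≤ n ^ a) (hnN : n ≤ N) (hn : 2 ≤ n) :
    ((1 + (2 * Nat.clog 2 N + 89 * (2 * Nat.clog 2 N + 1) * (132 * (K * L + 4) ^ 2)) : ℕ) : ℝ) ≤
      (4 * a * 100000 * (5 * K ^ 2) ^ 2) * δ ^ 2 * Real.logb 2 n := by
  have hL1 : (1 : ℝ) ≤ L := by exact_mod_cast Nat.one_le_iff_ne_zero.2 hL
  have hK : K ≠ 0 := by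
    rintro rfl
    simp at hLK
    exact hL hLK
  have hK1 : (1 : ℝ) ≤ K := by exact_mod_cast Nat.one_le_iff_ne_zero.2 hK
  set b := Nat.clog 2 N with hb
  have hb1 : 1 ≤ b := Nat.clog_pos one_lt_two (by omega)
  have hnR : (2 : ℝ) ≤ n := by exact_mod_cast hn
  have hlogN : (b : ℝ) ≤ 2 * (a * Real.logb 2 n) := by
    have h1 : (2 : ℝ) ^ (b - 1) ≤ (n : ℝ) ^ a := by
      have := (Nat.pow_pred_clog_lt_self one_lt_two (by omega : 1 < N)).le.trans hN
      exact_mod_cast this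
    have h2 := Real.logb_le_logb_of_le (b := 2) (by norm_num) (by positivity) h1
    rw [Real.logb_pow, Real.logb_pow, Real.logb_self_eq_one (by norm_num), mul_one,
      Nat.cast_sub hb1] at h2
    have ha : a ≠ 0 := by
      rintro rfl
      simp at hN
      omega
    have ha1 : (1 : ℝ) ≤ a := by exact_mod_cast Nat.one_le_iff_ne_zero.2 ha
    have h3 : (1 : ℝ) ≤ Real.logb 2 n := by
      rw [Real.le_logb_iff_rpow_le (by norm_num) (by linarith), Real.rpow_one]
      exact hnR
    have h4 : 1 ≤ a * Real.logb 2 n := by nlinarith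
    push_cast at h2
    linarith
  have hl : ((K * L + 4 : ℕ) : ℝ) ≤ 5 * K ^ 2 * δ := by
    push_cast
    have h1 : (1 : ℝ) ≤ K * L := by nlinarith
    have h2 : (K : ℝ) * L ≤ K * (K * δ) := mul_le_mul_of_nonneg_left hLK (by linarith)
    nlinarith
  have hbR : (1 : ℝ) ≤ b := by exact_mod_cast hb1
  have hlpos : (1 : ℝ) ≤ ((K * L + 4 : ℕ) : ℝ) := by exact_mod_cast (by omega : 1 ≤ K * L + 4)
  have hl2 : ((K * L + 4 : ℕ) : ℝ) ^ 2 ≤ (5 * K ^ 2) ^ 2 * δ ^ 2 := by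
    rw [← mul_pow]
    exact pow_le_pow_left₀ (by linarith) hl 2
  have hl1 : (1 : ℝ) ≤ ((K * L + 4 : ℕ) : ℝ) ^ 2 := one_le_pow₀ hlpos
  push_cast at hl2 hl1 ⊢
  set X : ℝ := ((K : ℝ) * L + 4) ^ 2
  have h1 : 1 + (2 * (b : ℝ) + 89 * (2 * b + 1) * (132 * X)) ≤ 200000 * (b * X) := by nlinarith
  have h2 : (b : ℝ) * X ≤ 2 * (a * Real.logb 2 n) * ((5 * K ^ 2) ^ 2 * δ ^ 2) :=
    mul_le_mul hlogN hl2 (by linarith) (by linarith)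
  linarith

/-- For all constants `a` and `K` there are a deterministic `LOCAL` algorithm and a constant `C`
such that, on every finite graph with `n` nodes and maximum degree `Δ`, whose nodes have distinct
identifiers below a number `N ≤ n ^ a` known to all nodes, and know `log Δ` up to the factor `K`,
the algorithm computes a maximal matching within `C * log² Δ * log n` rounds. -/
theorem theorem2 (a K : ℕ) :
    ∃ (A : LocalAlgorithm) (C : ℝ),
      ∀ (V : Type*) [Fintype V] (G : SimpleGraph V) [DecidableRel G.Adj]
        (net : Network G) (N L : ℕ),
        (∀ v : V, net.id v < N) →
        N ≤ Fintype.card V ^ a →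
        Real.logb 2 (G.maxDegree : ℝ) ≤ (K : ℝ) * (L : ℝ) →
        (L : ℝ) ≤ (K : ℝ) * Real.logb 2 (G.maxDegree : ℝ) →
        ∃ T : ℕ,
          (T : ℝ) ≤ C * Real.logb 2 (G.maxDegree : ℝ) ^ 2 * Real.logb 2 (Fintype.card V : ℝ) ∧
          A.ComputesMaximalMatchingWithin net N L T := by
  classical
  choose prog hlen hprog using exists_independentSetRules
  -- The default label has `sel = true`: it is output only for `L = 0`, where all edges are to be
  -- selected.
  refine ⟨simulate (fun N _ e => NodeLabel.fresh (pairColor (Nat.clog 2 N) e))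
    (fun N L => prog (K * L) (Nat.clog 2 N)) NodeLabel.sel ⟨0, 0, none, 0, 0, false, true⟩,
    4 * a * 100000 * (5 * K ^ 2) ^ 2, ?_⟩
  intro V _ G _ net N L hid hN hKL hLK
  have hfin : Fintype G.edgeSet := Fintype.ofFinite _
  have hδ : 0 ≤ Real.logb 2 (G.maxDegree : ℝ) := by
    rcases Nat.eq_zero_or_pos G.maxDegree with h | h
    · simp [h]
    · exact Real.logb_nonneg (by norm_num) (by exact_mod_cast h)
  have hΔ : G.maxDegree ≤ 2 ^ (K * L) := by
    rcases Nat.eq_zero_or_pos G.maxDegree with h | h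
    · rw [h]; exact Nat.zero_le _
    · have h1 := (Real.logb_le_iff_le_rpow (b := 2) (by norm_num)
        (by exact_mod_cast h : (0 : ℝ) < G.maxDegree)).1 hKL
      rw [← Nat.cast_mul, Real.rpow_natCast] at h1
      exact_mod_cast h1
  by_cases hL : L = 0
  · subst hL
    -- Here `Δ ≤ 1`, so the whole edge set is a matching. The time bound is 0, because `logb 2 Δ =
    -- 0`, so not even identifiers may be exchanged.
    refine ⟨0, ?_, {e | ∃ h : e ∈ G.edgeSet, True}, ?_,
      fun v => ⟨_, simulate_output_zero _ _ _ _ net N v, ?_⟩⟩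
    · have : 0 ≤ Real.logb 2 (Fintype.card V : ℝ) := by
        rcases Nat.eq_zero_or_pos (Fintype.card V) with h | h
        · simp [h]
        · exact Real.logb_nonneg (by norm_num) (by exact_mod_cast h)
      rw [Nat.cast_zero]
      positivity
    · refine isMaximalEdgeMatching_of_lineGraph (fun _ => True) (fun e f _ _ hadj => ?_)
        fun e he => absurd trivial he
      rw [mul_zero, pow_zero] at hΔ
      obtain ⟨hne, v, hv, hvf⟩ := SimpleGraph.lineGraph_adj_iff_exists.1 hadj
      have h4 : ({e, f} : Finset G.edgeSet) ⊆ edgesAt G v := by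
        intro g hg
        rw [Finset.mem_insert, Finset.mem_singleton] at hg
        rcases hg with rfl | rfl
        · exact mem_edgesAt.2 hv
        · exact mem_edgesAt.2 hvf
      have h5 := Finset.card_le_card h4
      rw [Finset.card_pair hne] at h5
      have h6 := (net.card_edgesAt_le v).trans (G.degree_le_maxDegree v)
      omega
    · intro p
      exact ⟨fun _ => ⟨net.adj_nbr v p, trivial⟩, fun _ => rfl⟩
  · set b := Nat.clog 2 N with hb
    have hNb : N ≤ 2 ^ b := Nat.le_pow_clog one_lt_two N
    have hidb : ∀ (e : G.edgeSet), ∀ x ∈ Sym2.map net.id e.1, x < 2 ^ b := by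
      intro e x hx
      obtain ⟨v, -, rfl⟩ := Sym2.mem_map.1 hx
      exact lt_of_lt_of_le (hid v) hNb
    have hdeg : ∀ e, (nbhd G.lineGraph e).card < 2 ^ (K * L + 1) := by
      intro e
      have := net.card_nbhd_lineGraph_lt e
      rw [pow_succ]
      omega
    obtain ⟨h1, h2⟩ := hprog (K * L) b G.edgeSet G.lineGraph twoCliqueNbhds_lineGraph hdeg
      (fun e => pairColor b (Sym2.map net.id e.1))
      (fun e f hef => Subtype.ext (Sym2.map.injective net.id_injective
        (pairColor_injOn _ _ (hidb e) (hidb f) hef)))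
      (fun e => pairColor_lt _ (hidb e))
    refine ⟨_, ?_, _, isMaximalEdgeMatching_of_lineGraph _ h1
      (fun e he => h2 e (by simpa using he)), fun v => ⟨_, simulate_output _ _ _ _ net N L hL v, ?_⟩⟩
    · have hcard : Fintype.card V ≤ N := by
        have := Fintype.card_le_of_injective (fun v => (⟨net.id v, hid v⟩ : Fin N))
          fun u v huv => net.id_injective (congrArg Fin.val huv)
        simpa using this
      -- A single node would force `Δ = 0` and hence `L = 0`.
      have hn : 2 ≤ Fintype.card V := by
        by_contra! hcon
        have hsub : Subsingleton V := Fintype.card_le_one_iff_subsingleton.1 (by omega)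
        have : G.maxDegree = 0 := by
          refine Nat.le_zero.1 (G.maxDegree_le_of_forall_degree_le 0 fun v => ?_)
          rw [Nat.le_zero, ← G.card_neighborFinset_eq_degree, Finset.card_eq_zero,
            Finset.eq_empty_iff_forall_notMem]
          intro w hw
          rw [SimpleGraph.mem_neighborFinset] at hw
          exact hw.ne (Subsingleton.elim _ _)
        rw [this] at hLK
        simp at hLK
        exact hL hLK
      refine le_trans ?_ (round_bound hL hLK hN hcard hn)
      exact_mod_cast Nat.add_le_add_left (hlen (K * L) b) 1
    · intro p
      exact ⟨fun h => ⟨net.adj_nbr v p, h⟩, fun ⟨_, h⟩ => h⟩
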